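/- Let $d\ge 2$ and let $\Gamma$ be a finite-index subgroup of $\mathbb{Z}^d$. Let $S\subset\Gamma$ be a finite set that generates $\Gamma$ as a group and satisfies $S=-S$ and $0\notin S$. Let $\mathrm{Cayley}(\Gamma,S)$ be the graph with vertex set $\Gamma$ in which $u$ and $v$ are adjacent if and only if $u-v\in S$. For each prime $p$, let $B_p$ be a uniformly random coset of $p\Gamma$ in $\Gamma$, the cosets $B_p$ being independent as $p$ ranges over the primes. An element of $\Gamma$ is called white if it belongs to $W:=\Gamma\setminus\bigcup_{p\text{ prime}}B_p$, and a white cluster is a connected component of the subgraph of $\mathrm{Cayley}(\Gamma,S)$ induced by $W$. Assume that for every $i\in\{1,\dots,d\}$ the following two conditions hold: (i) the set $\{x\in\Gamma : x_i=0\}$ is a connected subset of $\mathrm{Cayley}(\Gamma,S)$, i.e. it induces a connected subgraph; (ii) for any two adjacent vertices $x,z$ of $\mathrm{Cayley}(\Gamma,S)$ with $x_i<0<z_i$, there is some $y\in\Gamma$ with $y_i=0$ that is adjacent to $x$ or to $z$. Then, almost surely, the number of infinite white clusters is equal to $1$. -/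

import Mathlib

open MeasureTheory ProbabilityTheory

namespace CoprimeColouring

/-- The quotient `G / pG`: its elements are the cosets of `pG` in `G`. -/
def CosetSpace (G : Type*) [AddCommGroup G] (p : ℕ) : Type _ :=
  G ⧸ (nsmulAddMonoidHom p : G →+ G).range

/-- The coset of `pG` that contains `v`. -/
def cosetOf {G : Type*} [AddCommGroup G] (p : ℕ) (v : G) : CosetSpace G p :=
  QuotientAddGroup.mk' (nsmulAddMonoidHom p : G →+ G).range v

/-- Every set of cosets is measurable. -/
instance (G : Type*) [AddCommGroup G] (p : ℕ) : MeasurableSpace (CosetSpace G p) := ⊤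

instance (G : Type*) [AddCommGroup G] (p : ℕ) :
    DiscreteMeasurableSpace (CosetSpace G p) := ⟨fun _ => trivial⟩

instance (G : Type*) [AddCommGroup G] (p : ℕ) : Nonempty (CosetSpace G p) :=
  ⟨cosetOf p 0⟩

instance (G : Type*) [AddCommGroup G] [AddGroup.FG G] (p : Nat.Primes) :
    Finite (CosetSpace G p) := by
  let H : AddSubgroup G := (nsmulAddMonoidHom (p : ℕ) : G →+ G).range
  have : AddGroup.FG (G ⧸ H) := inferInstance
  refine AddCommGroup.finite_of_fg_isAddTorsion (G ⧸ H) ?_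
  intro x
  obtain ⟨v, rfl⟩ := QuotientAddGroup.mk_surjective x
  rw [isOfFinAddOrder_iff_nsmul_eq_zero]
  refine ⟨p, p.2.pos, ?_⟩
  rw [← QuotientAddGroup.mk_nsmul, QuotientAddGroup.eq_zero_iff]
  exact ⟨v, rfl⟩

instance {d : ℕ} (Γ : AddSubgroup (Fin d → ℤ)) : AddGroup.FG Γ :=
  Module.Finite.iff_addGroup_fg.mp
    (inferInstanceAs (Module.Finite ℤ (AddSubgroup.toIntSubmodule Γ)))

/-- The uniform probability measure on the finite set of cosets of `pG` in `G`. -/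
noncomputable def uniformCoset (G : Type*) [AddCommGroup G] (p : ℕ) :
    Measure (CosetSpace G p) :=
  uniformOn Set.univ

instance (G : Type*) [AddCommGroup G] [AddGroup.FG G] (p : Nat.Primes) :
    IsProbabilityMeasure (uniformCoset G p) :=
  isProbabilityMeasure_uniformOn Set.finite_univ Set.univ_nonempty

/-- The law of a family of independent uniform cosets of `pG` in `G`, one for each prime `p`. -/
noncomputable def cosetLaw (G : Type*) [AddCommGroup G] [AddGroup.FG G] :
    Measure ((p : Nat.Primes) → CosetSpace G p) :=
  Measure.infinitePi fun p : Nat.Primes => uniformCoset G p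

/-- The coset `B p` selected for the prime `p`, as a subset of `G`. -/
def selectedCoset {G : Type*} [AddCommGroup G]
    (B : (p : Nat.Primes) → CosetSpace G p) (p : Nat.Primes) : Set G :=
  {v | cosetOf p v = B p}

/-- The set of white vertices: those that lie in none of the selected cosets. -/
def white {G : Type*} [AddCommGroup G] (B : (p : Nat.Primes) → CosetSpace G p) : Set G :=
  (⋃ p, selectedCoset B p)ᶜ

/-- Admissible generating subsets: finite, symmetric, not containing `0`, and generating the
group. -/
structure Admissible {G : Type*} [AddCommGroup G] (S : Set G) : Prop where
  finite : S.Finite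
  neg_mem : ∀ s ∈ S, -s ∈ S
  zero_notMem : (0 : G) ∉ S
  closure_eq_top : AddSubgroup.closure S = ⊤

/-- For an admissible `S`, two vertices of the Cayley graph are adjacent if and only if their
difference lies in `S`. -/
theorem Admissible.adj_iff {G : Type*} [AddCommGroup G] {S : Set G} (hS : Admissible S)
    (u v : G) : (SimpleGraph.addCayley S).Adj u v ↔ u - v ∈ S := by
  rw [SimpleGraph.addCayley_adj]
  constructor
  · rintro ⟨-, h | h⟩
    · have := hS.neg_mem _ h
      rwa [show -(-u + v) = u - v by abel] at this
    · rwa [show -v + u = u - v by abel] at h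
  · intro h
    refine ⟨?_, Or.inr ?_⟩
    · rintro rfl
      exact hS.zero_notMem (by simpa using h)
    · rwa [show -v + u = u - v by abel]

/-- The set of infinite clusters of `U`: the connected components of the subgraph of `𝒢` induced
by `U` that have infinitely many vertices. -/
def infiniteClusters {V : Type*} (𝒢 : SimpleGraph V) (U : Set V) :
    Set (𝒢.induce U).ConnectedComponent :=
  {C | C.supp.Infinite}

end CoprimeColouring

/-!
# Uniqueness of the infinite white cluster

The hyperplanes `{x | φ i x = t}`, where `φ i` is the normalized `i`-th coordinate, provide long
white walls. The coset selected for `p` meets such a hyperplane if and only if its residue modulo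
`p` under `φ i` is that of `t`, which has probability `1 / p` only. So a hyperplane may avoid the
selected cosets of all primes up to some huge `N`, and in a box that is small compared to `N` the
larger primes do not matter: a point is selected by one of them with probability at most `∑ p⁻² ≤
1 / N` over `p > N` (`cosetLaw_exists_mem_box_le`).

The point is to find such hyperplanes at a distance from the origin much smaller than `N`
(`cosetLaw_real_forall_level_hit_le`). Let `z = 2 ^ k`, let `Q` be the product of the primes up to
`z`, and let `N = 2 ^ (D * z)`. By the Chinese remainder theorem, every interval of length `Q`
contains some `r` that is avoided by the primes up to `z`, and so are the `z ^ 3` levels `r + j *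
Q`. Each of them is avoided by the primes between `z` and `N` with probability at least of the
order of `z⁻²` (`one_div_sq_le_prod`, from Chebyshev's bound), and these events are almost
uncorrelated, since `j - j'` has at most a few prime factors larger than `z` (`prod_pair_le`). By
Chebyshev's inequality (`measureReal_inter_biInter_compl_le`) one of them occurs outside an event
of probability `O(1 / z)`. The levels concerned are at most `64 ^ z` in absolute value if the
interval is close to the origin, while `D` can be chosen such that `N` is larger than any given
power of `64 ^ (2 * z)`. By the Borel–Cantelli lemma, almost surely, for all large `k` and for all
directions there are white walls at a level between `k` and `64 ^ 2 ^ k`, and others at the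
opposite side of the origin, that are white up to a distance of the order of `64 ^ 2 ^ (k + 1)`.

It remains to argue deterministically (`exists_encard_infiniteClusters_eq_one`). Each wall is
connected, up to enlarging the box by a constant factor (`exists_joined_wall`). Two walls of
different directions of the same scale or of consecutive ones cross each other, hence they are in
the same cluster by the condition on crossing edges (`exists_joined_walls`). So all the walls are
in one cluster, which is infinite. Any infinite cluster has to leave the region bounded by the
walls of each large scale; so it contains a point of them, and it is that cluster.
-/

namespace CoprimeColouring

/-! ### Connections inside a vertex set -/

/-- `x` and `y` both lie in `U` and are connected by a path of `𝒢` that stays in `U`. -/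
def Joined {V : Type*} (𝒢 : SimpleGraph V) (U : Set V) (x y : V) : Prop :=
  ∃ (hx : x ∈ U) (hy : y ∈ U), (𝒢.induce U).Reachable ⟨x, hx⟩ ⟨y, hy⟩

namespace Joined

variable {V : Type*} {𝒢 : SimpleGraph V} {U U' : Set V} {x y z : V}

theorem left_mem (h : Joined 𝒢 U x y) : x ∈ U := h.1

theorem right_mem (h : Joined 𝒢 U x y) : y ∈ U := h.2.1

theorem refl (hx : x ∈ U) : Joined 𝒢 U x x := ⟨hx, hx, .refl _⟩

theorem symm (h : Joined 𝒢 U x y) : Joined 𝒢 U y x :=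
  let ⟨hx, hy, r⟩ := h
  ⟨hy, hx, r.symm⟩

theorem trans (h : Joined 𝒢 U x y) (h' : Joined 𝒢 U y z) : Joined 𝒢 U x z :=
  let ⟨hx, _, r⟩ := h
  let ⟨_, hz, r'⟩ := h'
  ⟨hx, hz, r.trans r'⟩

theorem of_adj (hx : x ∈ U) (hy : y ∈ U) (h : 𝒢.Adj x y) : Joined 𝒢 U x y :=
  ⟨hx, hy, SimpleGraph.Adj.reachable (by simpa using h)⟩

theorem map (f : 𝒢 →g 𝒢) (hf : Set.MapsTo f U U') (h : Joined 𝒢 U x y) :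
    Joined 𝒢 U' (f x) (f y) :=
  let ⟨hx, hy, r⟩ := h
  ⟨hf hx, hf hy, r.map (SimpleGraph.induceHom f hf)⟩

theorem mono (hU : U ⊆ U') (h : Joined 𝒢 U x y) : Joined 𝒢 U' x y :=
  h.map SimpleGraph.Hom.id (fun _ hx => hU hx)

/-- A property that holds at `x` and is inherited along edges of `U` holds at `y`. -/
theorem induction (h : Joined 𝒢 U x y) {P : V → Prop} (h0 : P x)
    (hstep : ∀ a b, Joined 𝒢 U x a → b ∈ U → 𝒢.Adj a b → P a → P b) : P y := by
  obtain ⟨hx, hy, r⟩ := h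
  rw [SimpleGraph.reachable_iff_reflTransGen] at r
  suffices H : ∀ v : U, Relation.ReflTransGen (𝒢.induce U).Adj ⟨x, hx⟩ v → P v from H _ r
  intro v hv
  induction hv with
  | refl => exact h0
  | @tail b c hb hbc ih =>
    exact hstep b c ⟨hx, b.2, (SimpleGraph.reachable_iff_reflTransGen _ _).2 hb⟩ c.2
      (by simpa using hbc) ih

/-- A path that leaves `Q` has an edge at which it does so. -/
theorem exists_exit (h : Joined 𝒢 U x y) {Q : Set V} (hx : x ∈ Q) (hy : y ∉ Q) :
    ∃ a b, a ∈ Q ∧ b ∉ Q ∧ 𝒢.Adj a b ∧ Joined 𝒢 U x a ∧ b ∈ U := by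
  by_contra! H
  refine hy (h.induction (P := fun v => v ∈ Q) hx fun a b ha hb hab haQ => ?_)
  by_contra hbQ
  exact H a b haQ hbQ hab ha hb

/-- A path stays in one of the sets of any increasing sequence that exhausts the vertices. -/
theorem exists_bounded (h : Joined 𝒢 U x y) {Λ : ℕ → Set V} (hΛ : Monotone Λ)
    (hcov : ∀ v, ∃ n, v ∈ Λ n) : ∃ n, Joined 𝒢 (U ∩ Λ n) x y := by
  refine h.induction (P := fun v => ∃ n, Joined 𝒢 (U ∩ Λ n) x v) ?_ ?_
  · obtain ⟨n, hn⟩ := hcov x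
    exact ⟨n, refl ⟨h.left_mem, hn⟩⟩
  · rintro a b - hb hab ⟨n, hn⟩
    obtain ⟨m, hm⟩ := hcov b
    have h1 : Joined 𝒢 (U ∩ Λ (max n m)) x a :=
      hn.mono (Set.inter_subset_inter_right _ (hΛ (le_max_left _ _)))
    exact ⟨max n m, h1.trans (of_adj h1.right_mem ⟨hb, hΛ (le_max_right _ _) hm⟩ hab)⟩

end Joined

/-! ### Boxes and walls -/

section Geometry

variable {G ι : Type*} [AddCommGroup G]

/-- The points of `G` all of whose coordinates are at most `L` in absolute value. -/
def box (φ : ι → G →+ ℤ) (L : ℤ) : Set G := {x | ∀ i, |φ i x| ≤ L}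

/-- The homomorphisms `φ i` are integer coordinates on `G`, normalized to be surjective; they embed
`G` into `ι → ℤ` in such a way that the image meets every coordinate axis outside `0`. -/
structure IsCoordinates (φ : ι → G →+ ℤ) : Prop where
  surjective : ∀ i, Function.Surjective (φ i)
  eq_zero : ∀ x, (∀ i, φ i x = 0) → x = 0
  exists_axis : ∀ i, ∃ e, 0 < φ i e ∧ ∀ j, j ≠ i → φ j e = 0

/-- In the Cayley graph of `S`, each hyperplane `{φ i = 0}` is connected, and no edge jumps over it
without one of its ends being adjacent to it. -/
structure HyperplanesSeparate (φ : ι → G →+ ℤ) (S : Set G) : Prop where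
  connected : ∀ i, ((SimpleGraph.addCayley S).induce {x : G | φ i x = 0}).Connected
  cross : ∀ i, ∀ x z : G, (SimpleGraph.addCayley S).Adj x z → φ i x < 0 → 0 < φ i z →
    ∃ y : G, ((SimpleGraph.addCayley S).Adj y x ∨ (SimpleGraph.addCayley S).Adj y z) ∧ φ i y = 0

/-- Translation by `g` as a homomorphism of the Cayley graph. -/
def translate {S : Set G} (hS : Admissible S) (g : G) :
    SimpleGraph.addCayley S →g SimpleGraph.addCayley S where
  toFun x := g + x
  map_rel' {a b} h := by
    rw [hS.adj_iff] at h ⊢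
    simpa using h

@[simp]
theorem translate_apply {S : Set G} (hS : Admissible S) (g x : G) :
    translate hS g x = g + x := rfl

variable {φ : ι → G →+ ℤ} {S : Set G}

theorem box_mono {L L' : ℤ} (h : L ≤ L') : box φ L ⊆ box φ L' := fun _ hx i => (hx i).trans h

theorem add_mem_box {L L' : ℤ} {x y : G} (hx : x ∈ box φ L) (hy : y ∈ box φ L') :
    x + y ∈ box φ (L + L') := fun i => by
  rw [map_add]
  exact (abs_add_le _ _).trans (add_le_add (hx i) (hy i))

theorem sub_mem_box {L L' : ℤ} {x y : G} (hx : x ∈ box φ L) (hy : y ∈ box φ L') :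
    x - y ∈ box φ (L + L') := fun i => by
  rw [map_sub]
  exact (abs_sub _ _).trans (add_le_add (hx i) (hy i))

theorem zsmul_mem_box {L c : ℤ} {x : G} (hx : x ∈ box φ L) : c • x ∈ box φ (|c| * L) := fun i => by
  rw [map_zsmul, smul_eq_mul, abs_mul]
  exact mul_le_mul_of_nonneg_left (hx i) (abs_nonneg _)

theorem coordinates_injective (hφ : IsCoordinates φ) : Function.Injective fun (x : G) i => φ i x := by
  intro x y hxy
  rw [← sub_eq_zero]
  refine hφ.eq_zero _ fun i => ?_
  rw [map_sub, sub_eq_zero]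
  exact congrFun hxy i

variable [Fintype ι]

theorem exists_mem_box (φ : ι → G →+ ℤ) (x : G) : ∃ n : ℕ, x ∈ box φ n := by
  obtain ⟨n, hn⟩ := Finite.bddAbove_range fun i => (φ i x).natAbs
  refine ⟨n, fun i => ?_⟩
  have : (φ i x).natAbs ≤ n := hn (Set.mem_range_self i)
  zify at this
  exact this

theorem _root_.Set.Finite.exists_subset_box (φ : ι → G →+ ℤ) {s : Set G} (hs : s.Finite) :
    ∃ n : ℕ, s ⊆ box φ n := by
  induction s, hs using Set.Finite.induction_on with
  | empty => exact ⟨0, Set.empty_subset _⟩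
  | @insert a s _ _ ih =>
    obtain ⟨n, hn⟩ := ih
    obtain ⟨m, hm⟩ := exists_mem_box φ a
    refine ⟨n + m, Set.insert_subset (box_mono (by simp) hm) (hn.trans (box_mono (by simp)))⟩

theorem box_finite (hφ : IsCoordinates φ) (L : ℤ) : (box φ L).Finite := by
  classical
  refine Set.Finite.of_finite_image (f := fun x i => φ i x) ?_ (coordinates_injective hφ).injOn
  refine (Set.finite_Icc (fun _ : ι => -L) (fun _ => L)).subset ?_
  rintro _ ⟨x, hx, rfl⟩
  exact ⟨fun i => (abs_le.1 (hx i)).1, fun i => (abs_le.1 (hx i)).2⟩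

theorem ncard_box_le (hφ : IsCoordinates φ) (L : ℕ) :
    (box φ L).ncard ≤ (2 * L + 1) ^ Fintype.card ι := by
  classical
  rw [← Set.ncard_image_of_injective _ (coordinates_injective hφ)]
  calc _ ≤ (Set.Icc (fun _ : ι => -(L : ℤ)) (fun _ => (L : ℤ))).ncard := by
        refine Set.ncard_le_ncard ?_ (Set.finite_Icc _ _)
        rintro _ ⟨x, hx, rfl⟩
        exact ⟨fun i => (abs_le.1 (hx i)).1, fun i => (abs_le.1 (hx i)).2⟩
    _ = _ := by
        rw [← Finset.coe_Icc, Set.ncard_coe_finset, Pi.card_Icc]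
        simp only [Int.card_Icc, Finset.prod_const, Finset.card_univ]
        congr 1
        omega

/-- Points of the hyperplane `{φ i = 0}` in a box are joined to `0` by a path that stays in that
hyperplane and in a box which is larger by a constant only: far away from `0`, steps along the axes
lead towards `0`, and each step is a translate of one of finitely many paths. -/
theorem exists_joined_zero (hφ : IsCoordinates φ) (hS : Admissible S)
    (hsep : HyperplanesSeparate φ S) :
    ∃ C : ℕ, ∀ i, ∀ L : ℕ, ∀ x, φ i x = 0 → x ∈ box φ L →
      Joined (SimpleGraph.addCayley S) ({y | φ i y = 0} ∩ box φ (L + C)) 0 x := by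
  choose e he_pos he_zero using hφ.exists_axis
  obtain ⟨c, hc⟩ := (Set.finite_range e).exists_subset_box φ
  have hmono : Monotone fun n : ℕ => box φ (n : ℤ) := fun a b hab => box_mono (by exact_mod_cast hab)
  have hnear : ∃ C : ℕ, ∀ i, ∀ x, φ i x = 0 → x ∈ box φ c →
      Joined (SimpleGraph.addCayley S) ({y | φ i y = 0} ∩ box φ C) 0 x := by
    have h1 : ∀ i x, ∃ n : ℕ, φ i x = 0 →
        Joined (SimpleGraph.addCayley S) ({y | φ i y = 0} ∩ box φ n) 0 x := by
      intro i x
      by_cases hx : φ i x = 0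
      · have h2 : Joined (SimpleGraph.addCayley S) {y | φ i y = 0} 0 x :=
          ⟨map_zero _, hx, (hsep.connected i).preconnected _ _⟩
        obtain ⟨n, hn⟩ := h2.exists_bounded hmono (exists_mem_box φ)
        exact ⟨n, fun _ => hn⟩
      · exact ⟨0, fun h => absurd h hx⟩
    choose n hn using h1
    have : Finite (box φ c) := box_finite hφ c
    obtain ⟨C, hC⟩ := Finite.bddAbove_range fun q : ι × box φ c => n q.1 q.2
    refine ⟨C, fun i x hx hxc => (hn i x hx).mono (Set.inter_subset_inter_right _ (hmono ?_))⟩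
    exact hC (Set.mem_range_self (i, (⟨x, hxc⟩ : box φ c)))
  obtain ⟨C, hC⟩ := hnear
  refine ⟨C, fun i L x hx hxL => ?_⟩
  have hCmono : ∀ n : ℤ, 0 ≤ n → ({y | φ i y = 0} ∩ box φ (C : ℤ)) ⊆
      {y | φ i y = 0} ∩ box φ (n + C) :=
    fun n hn => Set.inter_subset_inter_right _ (box_mono (by omega))
  induction hN : ∑ j, (φ j x).natAbs using Nat.strong_induction_on generalizing x with
  | _ N ih =>
  by_cases hxc : x ∈ box φ c
  · exact (hC i x hx hxc).mono (hCmono _ (by positivity))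
  · simp only [box, Set.mem_ofPred_eq, not_forall, not_le] at hxc
    obtain ⟨j, hj⟩ := hxc
    have hji : i ≠ j := by
      rintro rfl
      rw [hx, abs_zero] at hj
      exact absurd hj (by omega)
    have hej : |φ j (e j)| ≤ c := hc (Set.mem_range_self j) j
    have hej' := he_pos j
    -- the step along the `j`-th axis that decreases `|φ j x|`
    obtain ⟨ε, hε, hlt⟩ : ∃ ε : ℤ, |ε| = 1 ∧ |φ j x - ε * φ j (e j)| < |φ j x| := by
      rcases le_total 0 (φ j x) with h | h
      · refine ⟨1, rfl, ?_⟩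
        rw [abs_of_nonneg h] at hj ⊢
        rw [abs_lt]
        rw [abs_of_pos hej'] at hej
        constructor <;> linarith
      · refine ⟨-1, rfl, ?_⟩
        rw [abs_of_nonpos h] at hj ⊢
        rw [abs_lt]
        rw [abs_of_pos hej'] at hej
        constructor <;> linarith
    set s := ε • e j with hs
    have hsj : φ j s = ε * φ j (e j) := by rw [hs, map_zsmul, smul_eq_mul]
    have hsk : ∀ k, k ≠ j → φ k s = 0 := fun k hk => by rw [hs, map_zsmul, he_zero j k hk, smul_zero]
    have hsc : s ∈ box φ c := by
      have := zsmul_mem_box (c := ε) (hc (Set.mem_range_self j))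
      rwa [hε, one_mul] at this
    have hle : ∀ k, |φ k (x - s)| ≤ |φ k x| := fun k => by
      rw [map_sub]
      by_cases hk : k = j
      · subst hk
        rw [hsj]
        exact hlt.le
      · rw [hsk k hk, sub_zero]
    have hx' : φ i (x - s) = 0 := by rw [map_sub, hx, hsk i hji, sub_zero]
    have hx'L : x - s ∈ box φ L := fun k => (hle k).trans (hxL k)
    have hstep : Joined (SimpleGraph.addCayley S) ({y | φ i y = 0} ∩ box φ (L + C)) (x - s) x := by
      have h1 := (hC i s (hsk i hji) hsc).map (U' := {y | φ i y = 0} ∩ box φ (L + C))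
        (translate hS (x - s)) (by
          rintro v ⟨hv, hvC⟩
          refine ⟨?_, add_mem_box hx'L hvC⟩
          change φ i (x - s + v) = 0
          rw [map_add, hx', hv, add_zero])
      simpa using h1
    refine (ih _ ?_ (x - s) hx' hx'L rfl).trans hstep
    rw [← hN]
    refine Finset.sum_lt_sum (fun k _ => ?_) ⟨j, Finset.mem_univ _, ?_⟩
    · zify
      exact hle k
    · have : |φ j (x - s)| < |φ j x| := by rwa [map_sub, hsj]
      zify
      exact this

/-- A wall `{φ i = t}` is connected at every scale, up to enlarging the box by a constant factor. -/
theorem exists_joined_wall (hφ : IsCoordinates φ) (hS : Admissible S)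
    (hsep : HyperplanesSeparate φ S) :
    ∃ C : ℕ, ∀ i, ∀ t : ℤ, ∀ L : ℕ, ∀ x y, φ i x = t → φ i y = t → x ∈ box φ L → y ∈ box φ L →
      Joined (SimpleGraph.addCayley S) ({v | φ i v = t} ∩ box φ (3 * L + C)) x y := by
  obtain ⟨C, hC⟩ := exists_joined_zero hφ hS hsep
  refine ⟨C, fun i t L x y hx hy hxL hyL => ?_⟩
  have h1 := hC i (L + L) (y - x) (by rw [map_sub, hx, hy, sub_self])
    (by exact_mod_cast sub_mem_box hyL hxL)
  have h2 := h1.map (U' := {v | φ i v = t} ∩ box φ (3 * L + C)) (translate hS x) (by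
    rintro v ⟨hv, hvC⟩
    refine ⟨?_, ?_⟩
    · change φ i (x + v) = t
      rw [map_add, hx, hv, add_zero]
    · refine box_mono ?_ (add_mem_box hxL hvC)
      push_cast
      linarith)
  simpa using h2

theorem exists_adj_mem_box (φ : ι → G →+ ℤ) (hS : Admissible S) :
    ∃ C : ℕ, ∀ a b, (SimpleGraph.addCayley S).Adj a b → ∀ L, a ∈ box φ L → b ∈ box φ (L + C) := by
  obtain ⟨C, hC⟩ := hS.finite.exists_subset_box φ
  refine ⟨C, fun a b hab L ha => ?_⟩
  have := add_mem_box ha (hC ((hS.adj_iff b a).1 hab.symm))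
  simpa using this

/-- An edge of `U` that meets or jumps over the level `t` of `φ i` is joined inside `U` to a point
of the wall `{φ i = t}`, if `U` contains that wall locally. -/
theorem exists_joined_of_cross (hφ : IsCoordinates φ) (hS : Admissible S)
    (hsep : HyperplanesSeparate φ S) :
    ∃ C : ℕ, ∀ (U : Set G) (i : ι) (t L : ℤ), (∀ v ∈ box φ (L + C), φ i v = t → v ∈ U) →
      ∀ a b, (SimpleGraph.addCayley S).Adj a b → a ∈ U → b ∈ U → a ∈ box φ L →
      ((φ i a ≤ t ∧ t ≤ φ i b) ∨ (φ i b ≤ t ∧ t ≤ φ i a)) →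
      ∃ w ∈ box φ (L + C), φ i w = t ∧ Joined (SimpleGraph.addCayley S) U a w := by
  obtain ⟨C, hC⟩ := exists_adj_mem_box φ hS
  refine ⟨2 * C, fun U i t L hU a b hab ha hb haL hcr => ?_⟩
  have hbL := hC a b hab L haL
  have hmono : box φ (L + C) ⊆ box φ (L + (2 * C : ℕ)) := box_mono (by push_cast; linarith)
  have haL' : a ∈ box φ (L + (2 * C : ℕ)) := box_mono (by push_cast; linarith) haL
  by_cases hat : φ i a = t
  · exact ⟨a, haL', hat, .refl ha⟩
  by_cases hbt : φ i b = t
  · exact ⟨b, hmono hbL, hbt, .of_adj ha hb hab⟩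
  obtain ⟨g, hg⟩ := hφ.surjective i t
  have key : ∃ y, ((SimpleGraph.addCayley S).Adj y a ∨ (SimpleGraph.addCayley S).Adj y b) ∧
      φ i y = t := by
    have hab' : (SimpleGraph.addCayley S).Adj (-g + a) (-g + b) :=
      (translate hS (-g)).map_rel hab
    have back : ∀ y v, (SimpleGraph.addCayley S).Adj y (-g + v) →
        (SimpleGraph.addCayley S).Adj (g + y) v := fun y v h => by
      simpa using (translate hS g).map_rel h
    have hval : ∀ v, φ i (-g + v) = φ i v - t := fun v => by
      rw [map_add, map_neg, hg]
      ring
    rcases hcr with ⟨h1, h2⟩ | ⟨h1, h2⟩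
    · obtain ⟨y, hy, hy0⟩ := hsep.cross i _ _ hab' (by rw [hval]; omega) (by rw [hval]; omega)
      exact ⟨g + y, hy.imp (back _ _) (back _ _), by rw [map_add, hg, hy0, add_zero]⟩
    · obtain ⟨y, hy, hy0⟩ := hsep.cross i _ _ hab'.symm (by rw [hval]; omega) (by rw [hval]; omega)
      exact ⟨g + y, hy.symm.imp (back _ _) (back _ _), by rw [map_add, hg, hy0, add_zero]⟩
  obtain ⟨y, hy, hyt⟩ := key
  have hyL : y ∈ box φ (L + (2 * C : ℕ)) := by
    rcases hy with h | h
    · exact hmono (hC a y h.symm L haL)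
    · refine box_mono ?_ (hC b y h.symm _ hbL)
      push_cast
      linarith
  refine ⟨y, hyL, hyt, ?_⟩
  have hyU := hU y hyL hyt
  rcases hy with h | h
  · exact .of_adj ha hyU h.symm
  · exact (Joined.of_adj ha hb hab).trans (.of_adj hb hyU h.symm)

end Geometry

/-! ### White walls at all scales force a unique infinite cluster -/

section Geometry

variable {G ι : Type*} [AddCommGroup G] {φ : ι → G →+ ℤ} {S : Set G}

/-- The wall `{φ i = t}` is contained in `U`, as far as the box of size `L` is concerned. -/
def WallIn (φ : ι → G →+ ℤ) (U : Set G) (L : ℤ) (i : ι) (t : ℤ) : Prop :=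
  ∀ v ∈ box φ L, φ i v = t → v ∈ U

theorem WallIn.mono {U : Set G} {L L' : ℤ} {i : ι} {t : ℤ} (h : WallIn φ U L' i t) (hL : L ≤ L') :
    WallIn φ U L i t := fun v hv => h v (box_mono hL hv)

variable [Fintype ι]

/-- Every wall at a level between `-K` and `K` has points in a box of size proportional to `K`, on
either side of all such walls in any other direction. -/
theorem exists_mem_wall (hφ : IsCoordinates φ) :
    ∃ C : ℕ, ∀ K : ℕ, 1 ≤ K → ∀ i j, j ≠ i → ∀ t : ℤ, |t| ≤ K →
      ∃ x ∈ box φ (C * K), ∃ y ∈ box φ (C * K), φ i x = t ∧ φ i y = t ∧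
        φ j x < -K ∧ (K : ℤ) < φ j y := by
  choose e he_pos he_zero using hφ.exists_axis
  choose γ hγ using fun i => hφ.surjective i 1
  obtain ⟨c, hc⟩ := (Set.finite_range e).exists_subset_box φ
  obtain ⟨c', hc'⟩ := (Set.finite_range γ).exists_subset_box φ
  refine ⟨c' + (2 + c') * c, fun K hK i j hij t ht => ?_⟩
  have hbox : ∀ ε : ℤ, |ε| = 1 → t • γ i + (ε * ((2 + c') * K)) • e j ∈
      box φ ((c' + (2 + c') * c : ℕ) * K) := by
    intro ε hε
    refine box_mono ?_ (add_mem_box (zsmul_mem_box (hc' (Set.mem_range_self i)))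
      (zsmul_mem_box (hc (Set.mem_range_self j))))
    rw [abs_mul, hε, one_mul, abs_of_nonneg (by positivity : (0 : ℤ) ≤ (2 + c') * K)]
    have := mul_le_mul_of_nonneg_right ht (by positivity : (0 : ℤ) ≤ c')
    push_cast
    linarith
  have hi : ∀ ε : ℤ, φ i (t • γ i + (ε * ((2 + c') * K)) • e j) = t := fun ε => by
    rw [map_add, map_zsmul, map_zsmul, hγ, he_zero j i hij.symm]
    simp
  have hj : ∀ ε : ℤ, φ j (t • γ i + (ε * ((2 + c') * K)) • e j) =
      t * φ j (γ i) + ε * ((2 + c') * K * φ j (e j)) := fun ε => by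
    rw [map_add, map_zsmul, map_zsmul, smul_eq_mul, smul_eq_mul]
    ring
  have h1 : |t * φ j (γ i)| ≤ K * c' := by
    rw [abs_mul]
    exact mul_le_mul ht (hc' (Set.mem_range_self i) j) (abs_nonneg _) (by positivity)
  have h2 : ((2 + c') * K : ℤ) ≤ (2 + c') * K * φ j (e j) :=
    le_mul_of_one_le_right (by positivity) (he_pos j)
  have hK' : (1 : ℤ) ≤ K := by exact_mod_cast hK
  rw [abs_le] at h1
  refine ⟨_, hbox (-1) rfl, _, hbox 1 rfl, hi _, hi _, ?_, ?_⟩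
  · rw [hj]
    nlinarith
  · rw [hj]
    nlinarith

/-- Two walls of different directions, at levels between `-K` and `K` and contained in `U` near the
origin, belong to one and the same cluster of `U`; and so does every edge of `U` that meets or jumps
over one of them near the origin. The constant `R` gives the size of the part of the walls concerned,
which in particular is nonempty, and the constant `C` how far out they have to be contained in `U`.
-/
theorem exists_joined_walls (hφ : IsCoordinates φ) (hS : Admissible S)
    (hsep : HyperplanesSeparate φ S) :
    ∃ R C : ℕ,
      (∀ (K : ℕ), 1 ≤ K → ∀ U, ∀ i t, WallIn φ U (C * K) i t → ∀ a b,
        (SimpleGraph.addCayley S).Adj a b → a ∈ U → b ∈ U → a ∈ box φ K →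
        ((φ i a ≤ t ∧ t ≤ φ i b) ∨ (φ i b ≤ t ∧ t ≤ φ i a)) →
        ∃ w ∈ box φ (R * K), φ i w = t ∧ Joined (SimpleGraph.addCayley S) U a w) ∧
      ∀ K : ℕ, 1 ≤ K → ∀ (U : Set G) (i j : ι), i ≠ j → ∀ s t : ℤ, |s| ≤ K → |t| ≤ K →
        WallIn φ U (C * K) i s → WallIn φ U (C * K) j t →
        (∃ x ∈ box φ (R * K), φ i x = s) ∧
        ∀ x ∈ box φ (R * K), ∀ y ∈ box φ (R * K), φ i x = s → φ j y = t →
          Joined (SimpleGraph.addCayley S) U x y := by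
  obtain ⟨C1, hC1⟩ := exists_mem_wall hφ
  obtain ⟨C2, hC2⟩ := exists_joined_wall hφ hS hsep
  obtain ⟨C3, hC3⟩ := exists_joined_of_cross hφ hS hsep
  have hle : ∀ a K : ℕ, 1 ≤ K → a ≤ a * K := fun a K hK => Nat.le_mul_of_pos_right _ hK
  obtain ⟨R, hR⟩ : ∃ R, R = 3 * C1 + C2 + C3 + 1 := ⟨_, rfl⟩
  have hCR : ∀ K : ℕ, 1 ≤ K → (3 * (R * K : ℕ) + C2 : ℤ) ≤ (3 * R + C2 : ℕ) * K := fun K hK => by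
    have := hle C2 K hK
    push_cast
    zify at this
    linarith
  refine ⟨R, 3 * R + C2, fun K hK U i t hw a b hab ha hb haK hcr => ?_,
    fun K hK U i j hij s t hs ht hws hwt => ?_⟩
  · have h1 : (K + C3 : ℤ) ≤ R * K := by
      have := hle C3 K hK
      have h2 : K + C3 * K ≤ R * K := by
        calc K + C3 * K = (1 + C3) * K := by ring
          _ ≤ R * K := Nat.mul_le_mul_right _ (by omega)
      zify at this h2
      linarith
    have h3 : (K + C3 : ℤ) ≤ (3 * R + C2 : ℕ) * K := by
      have := hCR K hK
      have h4 : (0 : ℤ) ≤ R * K := by positivity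
      push_cast at this ⊢
      linarith
    obtain ⟨w, hw1, hw2, hw3⟩ := hC3 U i t K (hw.mono h3) a b hab ha hb haK hcr
    exact ⟨w, box_mono h1 hw1, hw2, hw3⟩
  obtain ⟨p, hp, q, hq, hps, hqs, hpt, hqt⟩ := hC1 K hK i j hij.symm s hs
  have hC1R : (C1 * K : ℤ) ≤ R * K :=
    mul_le_mul_of_nonneg_right (by exact_mod_cast (by omega : C1 ≤ R)) (by positivity)
  refine ⟨⟨p, box_mono hC1R hp, hps⟩, fun x hx y hy hxs hyt => ?_⟩
  -- the wall of direction `i` contains a path from one side of the other wall to its other side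
  have hpq := hC2 i s (C1 * K) p q hps hqs (by exact_mod_cast hp) (by exact_mod_cast hq)
  obtain ⟨a, b, haQ, hbQ, hab, hpa, hb⟩ := hpq.exists_exit (Q := {v | φ j v ≤ t})
    (by
      change φ j p ≤ t
      have := (abs_le.1 ht).1
      omega)
    (by
      change ¬ φ j q ≤ t
      have := (abs_le.1 ht).2
      omega)
  have ht' : ¬ φ j b ≤ t := hbQ
  have hLR : (3 * (C1 * K : ℕ) + C2 + C3 : ℤ) ≤ R * K := by
    have h2 := hle C2 K hK
    have h3 := hle C3 K hK
    have h4 : 3 * (C1 * K) + C2 * K + C3 * K ≤ R * K := by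
      rw [← mul_assoc, ← add_mul, ← add_mul]
      exact Nat.mul_le_mul_right _ (by omega)
    zify at h2 h3 h4
    push_cast
    linarith
  have hRC : (R * K : ℤ) ≤ (3 * R + C2 : ℕ) * K :=
    mul_le_mul_of_nonneg_right (by push_cast; linarith [(by positivity : (0 : ℤ) ≤ R)])
      (by positivity)
  have hsub : ({v | φ i v = s} ∩ box φ (3 * (C1 * K : ℕ) + C2)) ⊆ U := by
    rintro v ⟨hv, hvb⟩
    refine hws v (box_mono ?_ hvb) hv
    linarith [(by positivity : (0 : ℤ) ≤ C3)]
  obtain ⟨w, hwb, hwt', haw⟩ := hC3 U j t _ (hwt.mono (hLR.trans hRC)) a b hab (hsub hpa.right_mem)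
    (hsub hb) hpa.right_mem.2 (Or.inl ⟨haQ, (not_le.1 ht').le⟩)
  have hxp := (hC2 i s (R * K) x p hxs hps (by exact_mod_cast hx)
    (by exact_mod_cast box_mono hC1R hp)).mono (U' := U)
    (fun v hv => hws v (box_mono (hCR K hK) hv.2) hv.1)
  have hwy := (hC2 j t (R * K) w y hwt' hyt (by exact_mod_cast box_mono hLR hwb)
    (by exact_mod_cast hy)).mono (U' := U)
    (fun v hv => hwt v (box_mono (hCR K hK) hv.2) hv.1)
  exact ((hxp.trans (hpa.mono hsub)).trans haw).trans hwy

/-- If from some scale on there are walls of `U` in all directions, on either side of the origin,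
at a distance from it that tends to infinity, and if the walls of each scale extend far enough to
meet those of the next one, then `U` has exactly one infinite cluster. Indeed all these walls lie in
the same cluster, and a path to infinity meets the walls of every large scale. -/
theorem exists_encard_infiniteClusters_eq_one [Nontrivial ι] (hφ : IsCoordinates φ)
    (hS : Admissible S) (hsep : HyperplanesSeparate φ S) :
    ∃ C : ℕ, ∀ (K : ℕ → ℕ) (U : Set G) (k₀ : ℕ), Monotone K → (∀ k, 1 ≤ K k) →
      (∀ k, k₀ ≤ k → ∀ i,
        (∃ t : ℤ, k ≤ t ∧ t ≤ K k ∧ WallIn φ U (C * K (k + 1)) i t) ∧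
        ∃ t : ℤ, -K k ≤ t ∧ t ≤ -k ∧ WallIn φ U (C * K (k + 1)) i t) →
      (infiniteClusters (SimpleGraph.addCayley S) U).encard = 1 := by
  obtain ⟨R, C, hcross, hwalls⟩ := exists_joined_walls hφ hS hsep
  refine ⟨C, fun K U k₀ hK hK1 hU => ?_⟩
  choose tp htp1 htp2 htp3 using fun k hk i => (hU k hk i).1
  choose tm htm1 htm2 htm3 using fun k hk i => (hU k hk i).2
  -- the levels of the walls that are used at scale `k`
  let lev (k : ℕ) (i : ι) (t : ℤ) : Prop := |t| ≤ K k ∧ WallIn φ U (C * K (k + 1)) i t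
  have levp : ∀ k hk i, lev k i (tp k hk i) := fun k hk i =>
    ⟨abs_le.2 ⟨by have := htp1 k hk i; omega, htp2 k hk i⟩, htp3 k hk i⟩
  have levm : ∀ k hk i, lev k i (tm k hk i) := fun k hk i =>
    ⟨abs_le.2 ⟨htm1 k hk i, by have := htm2 k hk i; omega⟩, htm3 k hk i⟩
  have hKz : ∀ k l, k ≤ l → (K k : ℤ) ≤ K l := fun k l h => by exact_mod_cast hK h
  have hRK : ∀ k l, k ≤ l → (R * K k : ℤ) ≤ R * K l := fun k l h =>
    mul_le_mul_of_nonneg_left (hKz k l h) (by positivity)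
  -- walls of different directions at the same scale or at consecutive ones are joined
  have hjoin : ∀ k i j s t, i ≠ j → lev k i s → (lev k j t ∨ lev (k + 1) j t) →
      (∃ x ∈ box φ (R * K (k + 1)), φ i x = s) ∧
      ∀ x ∈ box φ (R * K (k + 1)), ∀ y ∈ box φ (R * K (k + 1)), φ i x = s → φ j y = t →
        Joined (SimpleGraph.addCayley S) U x y := by
    intro k i j s t hij hs ht
    refine hwalls (K (k + 1)) (hK1 _) U i j hij s t (hs.1.trans (hKz _ _ (by omega))) ?_ hs.2 ?_
    · rcases ht with h | h
      · exact h.1.trans (hKz _ _ (by omega))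
      · exact h.1
    · rcases ht with h | h
      · exact h.2
      · exact h.2.mono (mul_le_mul_of_nonneg_left (hKz _ _ (by omega)) (by positivity))
  obtain ⟨i₀, j₀, hij⟩ := exists_pair_ne ι
  choose p hpbox hpt using fun k (hk : k₀ ≤ k) =>
    (hwalls (K k) (hK1 _) U i₀ j₀ hij _ _ (levp k hk i₀).1 (levp k hk j₀).1
      ((levp k hk i₀).2.mono (mul_le_mul_of_nonneg_left (hKz _ _ (by omega)) (by positivity)))
      ((levp k hk j₀).2.mono (mul_le_mul_of_nonneg_left (hKz _ _ (by omega)) (by positivity)))).1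
  have hpbox' : ∀ k hk, p k hk ∈ box φ (R * K (k + 1)) := fun k hk =>
    box_mono (hRK _ _ (by omega)) (hpbox k hk)
  -- every wall of scale `k` is joined to the reference point `p k`
  have hwp : ∀ k hk i t, lev k i t → ∀ x ∈ box φ (R * K (k + 1)), φ i x = t →
      Joined (SimpleGraph.addCayley S) U x (p k hk) := by
    intro k hk i t ht x hx hxt
    by_cases hi : i = i₀
    · subst hi
      obtain ⟨⟨y, hy, hyt⟩, -⟩ := hjoin k j₀ i _ t hij.symm (levp k hk j₀) (Or.inl ht)
      exact ((hjoin k i j₀ t _ hij ht (Or.inl (levp k hk j₀))).2 x hx y hy hxt hyt).trans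
        ((hjoin k j₀ i _ _ hij.symm (levp k hk j₀) (Or.inl (levp k hk i))).2 y hy _
          (hpbox' k hk) hyt (hpt k hk))
    · exact (hjoin k i i₀ t _ hi ht (Or.inl (levp k hk i₀))).2 x hx _ (hpbox' k hk) hxt (hpt k hk)
  have hsucc : ∀ k hk hk', Joined (SimpleGraph.addCayley S) U (p k hk) (p (k + 1) hk') := by
    intro k hk hk'
    obtain ⟨⟨y, hy, hyt⟩, -⟩ := hjoin k j₀ i₀ _ _ hij.symm (levp k hk j₀) (Or.inl (levp k hk i₀))
    exact (hwp k hk j₀ _ (levp k hk j₀) y hy hyt).symm.trans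
      ((hjoin k j₀ i₀ _ _ hij.symm (levp k hk j₀) (Or.inr (levp (k + 1) hk' i₀))).2 y hy _
        (hpbox (k + 1) hk') hyt (hpt (k + 1) hk'))
  have hall : ∀ n hk, Joined (SimpleGraph.addCayley S) U (p k₀ le_rfl) (p (k₀ + n) hk) := by
    intro n
    induction n with
    | zero => exact fun hk => .refl (hsucc k₀ le_rfl (by omega)).left_mem
    | succ n ih => exact fun hk => (ih (by omega)).trans (hsucc _ _ _)
  have hall' : ∀ k hk, Joined (SimpleGraph.addCayley S) U (p k₀ le_rfl) (p k hk) := by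
    intro k hk
    obtain ⟨n, rfl⟩ := Nat.exists_eq_add_of_le hk
    exact hall n hk
  have hp₀ : p k₀ le_rfl ∈ U := (hall' k₀ le_rfl).left_mem
  refine Set.encard_eq_one.2 ⟨((SimpleGraph.addCayley S).induce U).connectedComponentMk
    ⟨p k₀ le_rfl, hp₀⟩, Set.eq_singleton_iff_unique_mem.2 ⟨?_, ?_⟩⟩
  · -- the `i₀`-th coordinate is unbounded on the cluster of the walls
    intro hfin
    obtain ⟨n, hn⟩ := (hfin.image Subtype.val).exists_subset_box φ
    have hk : k₀ ≤ k₀ + n + 1 := by omega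
    obtain ⟨_, h2, h3⟩ := hall' _ hk
    have h4 := hn ⟨⟨p _ hk, h2⟩, (SimpleGraph.ConnectedComponent.sound h3.symm), rfl⟩ i₀
    have h5 := htp1 _ hk i₀
    rw [hpt, abs_le] at h4
    push_cast at h5
    omega
  · intro D hD
    obtain ⟨⟨v, hvU⟩, rfl⟩ := D.exists_rep
    obtain ⟨n, hn⟩ := exists_mem_box φ v
    obtain ⟨k, hk, hkn⟩ : ∃ k, k₀ ≤ k ∧ n < k := ⟨k₀ + n + 1, by omega, by omega⟩
    -- the box that is bounded by the walls of scale `k`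
    let Q : Set G := {x | ∀ i, tm k hk i < φ i x ∧ φ i x < tp k hk i}
    have hQ : Q ⊆ box φ (K k) := fun x hx i => abs_le.2
      ⟨(htm1 k hk i).trans (hx i).1.le, (hx i).2.le.trans (htp2 k hk i)⟩
    have hvQ : v ∈ Q := fun i => by
      have h1 := abs_le.1 (hn i)
      have h2 := htp1 k hk i
      have h3 := htm2 k hk i
      omega
    obtain ⟨w, hw, hwQ⟩ : ∃ w : U, ((SimpleGraph.addCayley S).induce U).Reachable ⟨v, hvU⟩ w ∧
        (w : G) ∉ Q := by
      by_contra! H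
      refine hD (Set.Finite.of_finite_image (f := Subtype.val)
        (((box_finite hφ (K k)).subset hQ).subset ?_) Subtype.val_injective.injOn)
      rintro _ ⟨w, hw, rfl⟩
      exact H w (SimpleGraph.ConnectedComponent.exact hw).symm
    have hvw : Joined (SimpleGraph.addCayley S) U v w := ⟨hvU, w.2, hw⟩
    obtain ⟨a, b, haQ, hbQ, hab, hva, hbU⟩ := hvw.exists_exit hvQ hwQ
    obtain ⟨i, hi⟩ : ∃ i, ¬ (tm k hk i < φ i b ∧ φ i b < tp k hk i) := by
      by_contra! H
      exact hbQ H
    have hai := haQ i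
    obtain ⟨t, ht, hcr⟩ : ∃ t, lev k i t ∧
        ((φ i a ≤ t ∧ t ≤ φ i b) ∨ (φ i b ≤ t ∧ t ≤ φ i a)) := by
      by_cases h : tm k hk i < φ i b
      · exact ⟨_, levp k hk i, by omega⟩
      · exact ⟨_, levm k hk i, by omega⟩
    obtain ⟨w', hw', hw't, haw'⟩ := hcross (K k) (hK1 _) U i t
      (ht.2.mono (mul_le_mul_of_nonneg_left (hKz _ _ (by omega)) (by positivity)))
      a b hab hva.right_mem hbU (hQ haQ) hcr
    have hfin := ((hva.trans haw').trans
      (hwp k hk i t ht w' (box_mono (hRK _ _ (by omega)) hw') hw't)).trans (hall' k hk).symm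
    exact SimpleGraph.ConnectedComponent.sound hfin.2.2

end Geometry

/-! ### Products over primes -/

/-- The primes `p` with `a < p ≤ b`. -/
def primesIoc (a b : ℕ) : Finset Nat.Primes := (Finset.Ioc a b).subtype Nat.Prime

@[simp]
theorem mem_primesIoc {a b : ℕ} {p : Nat.Primes} :
    p ∈ primesIoc a b ↔ a < (p : ℕ) ∧ (p : ℕ) ≤ b := by
  rw [primesIoc]
  exact Finset.mem_subtype.trans Finset.mem_Ioc

theorem prod_primesIoc {M : Type*} [CommMonoid M] (f : ℕ → M) (a b : ℕ) :
    ∏ p ∈ primesIoc a b, f p = ∏ p ∈ Finset.Ioc a b with p.Prime, f p :=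
  Finset.prod_subtype_eq_prod_filter f

theorem prod_primesIoc_zero (n : ℕ) : ∏ p ∈ primesIoc 0 n, (p : ℕ) = primorial n := by
  rw [prod_primesIoc (fun p => p), primorial]
  refine Finset.prod_congr ?_ fun _ _ => rfl
  ext p
  simp only [Finset.mem_filter, Finset.mem_Ioc, Finset.mem_range]
  constructor
  · rintro ⟨h, hp⟩
    exact ⟨by omega, hp⟩
  · rintro ⟨h, hp⟩
    exact ⟨⟨hp.pos, by omega⟩, hp⟩

theorem disjoint_primesIoc (a b c : ℕ) : Disjoint (primesIoc a b) (primesIoc b c) := by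
  rw [Finset.disjoint_left]
  intro p hp hp'
  rw [mem_primesIoc] at hp hp'
  omega

theorem primesIoc_union {a b c : ℕ} (h : a ≤ b) (h' : b ≤ c) :
    primesIoc a c = primesIoc a b ∪ primesIoc b c := by
  ext p
  simp only [mem_primesIoc, Finset.mem_union]
  omega

theorem one_sub_sum_le_prod {α : Type*} (s : Finset α) (f : α → ℝ) (h0 : ∀ a ∈ s, 0 ≤ f a)
    (h1 : ∀ a ∈ s, f a ≤ 1) : 1 - ∑ a ∈ s, f a ≤ ∏ a ∈ s, (1 - f a) := by
  classical
  induction s using Finset.induction_on with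
  | empty => simp
  | @insert a s ha ih =>
    rw [Finset.sum_insert ha, Finset.prod_insert ha]
    have hs := ih (fun b hb => h0 b (Finset.mem_insert_of_mem hb))
      fun b hb => h1 b (Finset.mem_insert_of_mem hb)
    have ha0 := h0 a (Finset.mem_insert_self _ _)
    have ha1 := h1 a (Finset.mem_insert_self _ _)
    have hs0 : 0 ≤ ∑ b ∈ s, f b :=
      Finset.sum_nonneg fun b hb => h0 b (Finset.mem_insert_of_mem hb)
    calc 1 - (f a + ∑ b ∈ s, f b) ≤ (1 - f a) * (1 - ∑ b ∈ s, f b) := by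
          nlinarith [mul_nonneg ha0 hs0]
      _ ≤ _ := mul_le_mul_of_nonneg_left hs (by linarith)

theorem one_div_prime_le_one (p : Nat.Primes) : 1 / (p : ℝ) ≤ 1 := by
  rw [div_le_one (by exact_mod_cast p.2.pos)]
  exact_mod_cast p.2.one_le

theorem one_sub_one_div_prime_pos (p : Nat.Primes) : 0 < 1 - 1 / (p : ℝ) := by
  rw [sub_pos, div_lt_one (by exact_mod_cast p.2.pos)]
  exact_mod_cast p.2.one_lt

/-- Chebyshev's bound for the number of primes in a dyadic interval. -/
theorem card_primesIoc_two_pow (j : ℕ) :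
    (primesIoc (2 ^ j) (2 ^ (j + 1))).card * j ≤ 2 * 2 ^ j := by
  have h1 : ∏ p ∈ primesIoc (2 ^ j) (2 ^ (j + 1)), (p : ℕ) ≤ 4 ^ (2 ^ j) := by
    have h2 : primorial (2 ^ j + 2 ^ j) =
        primorial (2 ^ j) * ∏ p ∈ primesIoc (2 ^ j) (2 ^ (j + 1)), (p : ℕ) := by
      rw [← prod_primesIoc_zero, ← prod_primesIoc_zero, ← two_mul, ← pow_succ',
        primesIoc_union (Nat.zero_le (2 ^ j)) (Nat.pow_le_pow_right two_pos (Nat.le_succ j)),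
        Finset.prod_union (disjoint_primesIoc _ _ _)]
    have h3 := primorial_add_le (le_refl (2 ^ j))
    rw [h2] at h3
    refine (Nat.le_of_mul_le_mul_left h3 (primorial_pos _)).trans ?_
    rw [← two_mul]
    exact Nat.centralBinom_le_four_pow _
  have h4 : (2 ^ j) ^ (primesIoc (2 ^ j) (2 ^ (j + 1))).card ≤
      ∏ p ∈ primesIoc (2 ^ j) (2 ^ (j + 1)), (p : ℕ) :=
    Finset.pow_card_le_prod _ _ _ fun p hp => (mem_primesIoc.1 hp).1.le
  have h5 := h4.trans h1
  rw [← pow_mul, show (4 : ℕ) = 2 ^ 2 from rfl, ← pow_mul] at h5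
  rw [mul_comm]
  exact (Nat.pow_le_pow_iff_right one_lt_two).1 h5

/-- A lower bound of Mertens type for the sifting density of the primes in `(2 ^ k, 2 ^ M]`. -/
theorem one_div_sq_le_prod {k M : ℕ} (hk : 3 ≤ k) (hM : k ≤ M) :
    1 / (M : ℝ) ^ 2 ≤ ∏ p ∈ primesIoc (2 ^ k) (2 ^ M), (1 - 1 / (p : ℝ)) := by
  have hk' : (3 : ℝ) ≤ k := by exact_mod_cast hk
  have key : ((k : ℝ) - 2) * (k - 1) / ((M - 2) * (M - 1)) ≤
      ∏ p ∈ primesIoc (2 ^ k) (2 ^ M), (1 - 1 / (p : ℝ)) := by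
    induction M, hM using Nat.le_induction with
    | base =>
      rw [div_self (by nlinarith)]
      have : primesIoc (2 ^ k) (2 ^ k) = ∅ := by
        ext p
        simp only [mem_primesIoc, Finset.notMem_empty, iff_false]
        omega
      rw [this, Finset.prod_empty]
    | succ M hM ih =>
      have hM' : (k : ℝ) ≤ M := by exact_mod_cast hM
      rw [primesIoc_union (Nat.pow_le_pow_right two_pos hM)
        (Nat.pow_le_pow_right two_pos (Nat.le_succ M)), Finset.prod_union (disjoint_primesIoc _ _ _)]
      have hstep : ((M : ℝ) - 2) / M ≤
          ∏ p ∈ primesIoc (2 ^ M) (2 ^ (M + 1)), (1 - 1 / (p : ℝ)) := by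
        refine le_trans ?_ (one_sub_sum_le_prod _ _ (fun p _ => by positivity)
          fun p _ => one_div_prime_le_one p)
        have h1 : ∑ p ∈ primesIoc (2 ^ M) (2 ^ (M + 1)), 1 / (p : ℝ) ≤
            (primesIoc (2 ^ M) (2 ^ (M + 1))).card * (1 / 2 ^ M) := by
          rw [← nsmul_eq_mul]
          refine Finset.sum_le_card_nsmul _ _ _ fun p hp => ?_
          refine one_div_le_one_div_of_le (by positivity) ?_
          exact_mod_cast (mem_primesIoc.1 hp).1.le
        have h2 : ((primesIoc (2 ^ M) (2 ^ (M + 1))).card : ℝ) * M ≤ 2 * 2 ^ M := by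
          exact_mod_cast card_primesIoc_two_pow M
        have h3 : ((primesIoc (2 ^ M) (2 ^ (M + 1))).card : ℝ) * (1 / 2 ^ M) ≤ 2 / M := by
          rw [mul_one_div, div_le_div_iff₀ (by positivity) (by linarith)]
          exact h2
        have h4 : ((M : ℝ) - 2) / M = 1 - 2 / M := by
          rw [sub_div, div_self (by linarith)]
        linarith
      calc _ = ((k : ℝ) - 2) * (k - 1) / ((M - 2) * (M - 1)) * (((M : ℝ) - 2) / M) := by
            have h1 : (M : ℝ) - 2 ≠ 0 := by linarith
            have h2 : (M : ℝ) - 1 ≠ 0 := by linarith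
            have h3 : (M : ℝ) ≠ 0 := by linarith
            rw [Nat.cast_succ, show (M : ℝ) + 1 - 2 = M - 1 by ring,
              show (M : ℝ) + 1 - 1 = M by ring]
            field_simp
        _ ≤ _ := mul_le_mul ih hstep (div_nonneg (by linarith) (by linarith))
            (Finset.prod_nonneg fun p _ => (one_sub_one_div_prime_pos p).le)
  refine le_trans ?_ key
  have hM' : (k : ℝ) ≤ M := by exact_mod_cast hM
  refine div_le_div₀ (by nlinarith) (by nlinarith) (by nlinarith) (by nlinarith)

/-- The sifting density of pairs of integers whose difference is `h`, for primes larger than `z`: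
up to the few prime factors of `h`, it is at most the square of the density of single integers. -/
theorem prod_pair_le {z N h : ℕ} (hz : 4 ≤ z) (h0 : h ≠ 0) (hh : h < z ^ 3) :
    ∏ p ∈ primesIoc z N, (if (p : ℕ) ∣ h then 1 - 1 / (p : ℝ) else 1 - 2 / (p : ℝ)) ≤
      (1 + 12 / z) * (∏ p ∈ primesIoc z N, (1 - 1 / (p : ℝ))) ^ 2 := by
  set s := primesIoc z N with hs
  set D := s.filter fun p : Nat.Primes => (p : ℕ) ∣ h with hD
  have hz' : (4 : ℝ) ≤ z := by exact_mod_cast hz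
  have hDcard : D.card ≤ 3 := by
    have h1 : z ^ D.card ≤ ∏ p ∈ D, (p : ℕ) := Finset.pow_card_le_prod _ _ _ fun p hp =>
      (mem_primesIoc.1 (Finset.mem_filter.1 hp).1).1.le
    have h2 : ∏ p ∈ D, (p : ℕ) ∣ h := by
      let e : Nat.Primes ↪ ℕ := ⟨fun p => p, Nat.Primes.coe_nat_injective⟩
      have := Finset.prod_primes_dvd (s := D.map e) h
        (fun p hp => by
          obtain ⟨q, -, rfl⟩ := Finset.mem_map.1 hp
          exact q.2.prime)
        (fun p hp => by
          obtain ⟨q, hq, rfl⟩ := Finset.mem_map.1 hp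
          exact (Finset.mem_filter.1 hq).2)
      have h3 : ∏ p ∈ D.map e, p = ∏ p ∈ D, (p : ℕ) := Finset.prod_map D e _
      rwa [h3] at this
    have h3 := (h1.trans (Nat.le_of_dvd (Nat.pos_of_ne_zero h0) h2)).trans_lt hh
    exact ((Nat.pow_lt_pow_iff_right (by omega)).1 h3).le
  have hDprod : 1 - 3 / (z : ℝ) ≤ ∏ p ∈ D, (1 - 1 / (p : ℝ)) := by
    refine le_trans ?_ (one_sub_sum_le_prod _ _ (fun p _ => by positivity)
      fun p _ => one_div_prime_le_one p)
    have h1 : ∑ p ∈ D, 1 / (p : ℝ) ≤ D.card * (1 / z) := by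
      rw [← nsmul_eq_mul]
      refine Finset.sum_le_card_nsmul _ _ _ fun p hp => ?_
      refine one_div_le_one_div_of_le (by linarith) ?_
      exact_mod_cast (mem_primesIoc.1 (Finset.mem_filter.1 hp).1).1.le
    have h2 : (D.card : ℝ) * (1 / z) ≤ 3 * (1 / z) :=
      mul_le_mul_of_nonneg_right (by exact_mod_cast hDcard) (by positivity)
    have h3 : 3 * (1 / (z : ℝ)) = 3 / z := mul_one_div _ _
    linarith
  have hnn : ∀ p ∈ s, 0 ≤ (if (p : ℕ) ∣ h then 1 - 1 / (p : ℝ) else 1 - 2 / (p : ℝ)) := by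
    intro p hp
    have hp2 : (2 : ℝ) ≤ p := by exact_mod_cast p.2.two_le
    split_ifs
    · exact (one_sub_one_div_prime_pos p).le
    · rw [sub_nonneg, div_le_one (by linarith)]
      exact hp2
  have hmain : (∏ p ∈ s, (if (p : ℕ) ∣ h then 1 - 1 / (p : ℝ) else 1 - 2 / (p : ℝ))) *
      ∏ p ∈ D, (1 - 1 / (p : ℝ)) ≤ (∏ p ∈ s, (1 - 1 / (p : ℝ))) ^ 2 := by
    rw [hD, Finset.prod_filter, ← Finset.prod_mul_distrib, ← Finset.prod_pow]
    refine Finset.prod_le_prod (fun p hp => mul_nonneg (hnn p hp) ?_) fun p hp => ?_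
    · split_ifs
      · exact (one_sub_one_div_prime_pos p).le
      · exact zero_le_one
    · split_ifs
      · exact (sq _).ge
      · have : (0 : ℝ) ≤ (1 / (p : ℝ)) ^ 2 := sq_nonneg _
        have h2 : 2 / (p : ℝ) = 2 * (1 / p) := by ring
        rw [h2]
        nlinarith
  have h1 : (1 : ℝ) ≤ (1 + 12 / z) * (1 - 3 / z) := by
    have h2 : (1 + 12 / (z : ℝ)) * (1 - 3 / z) = 1 + 9 / z * (1 - 4 / z) := by
      ring
    rw [h2]
    have h3 : 4 / (z : ℝ) ≤ 1 := by rw [div_le_one (by linarith)]; exact hz'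
    have h4 : 0 ≤ 9 / (z : ℝ) * (1 - 4 / z) := mul_nonneg (by positivity) (by linarith)
    linarith
  have hprod := Finset.prod_nonneg hnn
  calc _ ≤ ((1 + 12 / (z : ℝ)) * ∏ p ∈ D, (1 - 1 / (p : ℝ))) *
        ∏ p ∈ s, (if (p : ℕ) ∣ h then 1 - 1 / (p : ℝ) else 1 - 2 / (p : ℝ)) :=
        le_mul_of_one_le_left hprod
          (h1.trans (mul_le_mul_of_nonneg_left hDprod (by positivity)))
    _ = (1 + 12 / (z : ℝ)) * ((∏ p ∈ s,
        (if (p : ℕ) ∣ h then 1 - 1 / (p : ℝ) else 1 - 2 / (p : ℝ))) *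
        ∏ p ∈ D, (1 - 1 / (p : ℝ))) := by ring
    _ ≤ _ := mul_le_mul_of_nonneg_left hmain (by positivity)

/-- Residues modulo the primes up to `z` can be prescribed in any interval of length
`primorial z`. -/
theorem exists_int_residues (x : (p : Nat.Primes) → ZMod p) (z : ℕ) (a : ℤ) :
    ∃ r : ℤ, a ≤ r ∧ r < a + primorial z ∧ ∀ p ∈ primesIoc 0 z, (r : ZMod p) = x p := by
  have hcop : (primesIoc 0 z : Set Nat.Primes).Pairwise
      (Function.onFun Nat.Coprime fun p : Nat.Primes => (p : ℕ)) := fun p _ q _ hpq =>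
    (Nat.coprime_primes p.2 q.2).2 fun h => hpq (Subtype.ext h)
  obtain ⟨n, hn⟩ := Nat.chineseRemainderOfFinset (fun p : Nat.Primes => (x p).val)
    (fun p : Nat.Primes => (p : ℕ)) (primesIoc 0 z) (fun p _ => p.2.ne_zero) hcop
  have hQ : (0 : ℤ) < primorial z := by exact_mod_cast primorial_pos z
  refine ⟨a + (n - a) % primorial z, ?_, ?_, fun p hp => ?_⟩
  · linarith [Int.emod_nonneg (n - a) hQ.ne']
  · linarith [Int.emod_lt_of_pos (n - a) hQ]
  · have : NeZero (p : ℕ) := ⟨p.2.ne_zero⟩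
    have hpQ : (p : ℤ) ∣ primorial z := by
      exact_mod_cast p.2.dvd_primorial_iff.2 (mem_primesIoc.1 hp).2
    have h1 : ((n : ℤ) : ZMod p) = x p := by
      have := (ZMod.natCast_eq_natCast_iff _ _ _).2 (hn p hp)
      rw [ZMod.natCast_val, ZMod.cast_id] at this
      exact_mod_cast this
    rw [← h1, ZMod.intCast_eq_intCast_iff_dvd_sub]
    refine hpQ.trans ⟨(n - a) / primorial z, ?_⟩
    have := Int.emod_add_mul_ediv (n - a) (primorial z)
    linarith

/-! ### Residues of the selected cosets -/

instance neZeroPrimes (p : Nat.Primes) : NeZero (p : ℕ) := ⟨p.2.ne_zero⟩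

section Residues

variable {G : Type*} [AddCommGroup G]

/-- The residue modulo `p` of the values of `f` on a coset of `pG`. -/
def residue (f : G →+ ℤ) (p : ℕ) : CosetSpace G p → ZMod p :=
  (QuotientAddGroup.lift (nsmulAddMonoidHom p : G →+ G).range
    ((Int.castAddHom (ZMod p)).comp f) (by
      rintro _ ⟨v, rfl⟩
      simp) : G ⧸ (nsmulAddMonoidHom p : G →+ G).range →+ ZMod p)

@[simp]
theorem residue_cosetOf (f : G →+ ℤ) (p : ℕ) (v : G) : residue f p (cosetOf p v) = f v := rfl

theorem uniformCoset_real [AddGroup.FG G] (p : Nat.Primes) (s : Set (CosetSpace G p)) :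
    (uniformCoset G p).real s = s.ncard / Nat.card (CosetSpace G p) := by
  classical
  let _ := Fintype.ofFinite (CosetSpace G p)
  rw [measureReal_def, uniformCoset, uniformOn_univ, ← Set.coe_toFinset s,
    Measure.count_apply_finset, ENNReal.toReal_div, Set.ncard_coe_finset, Nat.card_eq_fintype_card]
  simp

/-- The residue modulo `p` of a surjective homomorphism on a uniform coset is uniform. -/
theorem uniformCoset_real_residue [AddGroup.FG G] {f : G →+ ℤ} (hf : Function.Surjective f)
    (p : Nat.Primes) (T : Finset (ZMod p)) :
    (uniformCoset G p).real {b | residue f p b ∈ T} = T.card / (p : ℝ) := by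
  classical
  let H : AddSubgroup G := (nsmulAddMonoidHom (p : ℕ) : G →+ G).range
  let ψ : G ⧸ H →+ ZMod p := QuotientAddGroup.lift H ((Int.castAddHom (ZMod p)).comp f) (by
      rintro _ ⟨v, rfl⟩
      simp)
  have : Finite (G ⧸ H) := inferInstanceAs (Finite (CosetSpace G p))
  let _ := Fintype.ofFinite (G ⧸ H)
  have hsurj : Function.Surjective ψ := by
    intro t
    obtain ⟨n, rfl⟩ := ZMod.intCast_surjective t
    obtain ⟨v, rfl⟩ := hf n
    exact ⟨QuotientAddGroup.mk' H v, rfl⟩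
  have hfib : ∀ t, (Finset.univ.filter fun b => ψ b = t).card =
      (Finset.univ.filter fun b => ψ b = 0).card := fun t =>
    AddMonoidHom.card_fiber_eq_of_mem_range ψ (hsurj t) (hsurj 0)
  have hT : ∀ T : Finset (ZMod p), (Finset.univ.filter fun b => ψ b ∈ T).card =
      T.card * (Finset.univ.filter fun b => ψ b = 0).card := by
    intro T
    rw [Finset.card_eq_sum_card_fiberwise (f := ψ) (t := T) (by
      intro b hb
      simpa using hb), ← smul_eq_mul, ← Finset.sum_const]
    refine Finset.sum_congr rfl fun t ht => ?_
    rw [← hfib t, Finset.filter_filter]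
    congr 1
    ext b
    simp only [Finset.mem_filter, Finset.mem_univ, true_and]
    constructor
    · exact fun h => h.2
    · exact fun h => ⟨h ▸ ht, h⟩
  have huniv := hT Finset.univ
  simp only [Finset.mem_univ, Finset.filter_true, Finset.card_univ, ZMod.card] at huniv
  have h1 : (uniformCoset G p).real {b | residue f p b ∈ T} =
      ((Finset.univ.filter fun b => ψ b ∈ T).card : ℝ) / Fintype.card (G ⧸ H) := by
    rw [uniformCoset_real, ← Nat.card_eq_fintype_card, ← Set.ncard_coe_finset]
    congr 3
    ext b
    simp
    rfl
  have hpos : 0 < Fintype.card (G ⧸ H) := Fintype.card_pos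
  rw [huniv] at hpos
  have hpos' : (0 : ℝ) < (Finset.univ.filter fun b => ψ b = 0).card := by
    exact_mod_cast pos_of_mul_pos_right hpos (Nat.zero_le _)
  rw [h1, hT, huniv]
  push_cast
  rw [mul_div_mul_right _ _ hpos'.ne']

/-- A given point lies in the selected coset of a large prime `p` with probability at most `p⁻²`:
the multiples of two axis vectors provide `p ^ 2` distinct cosets. -/
theorem uniformCoset_real_singleton_le [AddGroup.FG G] {ι : Type*} [Nontrivial ι]
    {φ : ι → G →+ ℤ} {e : ι → G} (he : ∀ i, 0 < φ i (e i)) (he0 : ∀ i j, j ≠ i → φ j (e i) = 0)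
    {N : ℕ} (hN : ∀ i, φ i (e i) ≤ N) (p : Nat.Primes) (hp : N < p) (b : CosetSpace G p) :
    (uniformCoset G p).real {b} ≤ ((p : ℝ) ^ 2)⁻¹ := by
  obtain ⟨i, j, hij⟩ := exists_pair_ne ι
  let g : Fin p × Fin p → CosetSpace G p := fun q => cosetOf p (q.1.1 • e i + q.2.1 • e j)
  have hcop : ∀ i, ∀ x y : Fin p, (x.1 * φ i (e i) : ZMod p) = y.1 * φ i (e i) → x = y := by
    intro i x y h
    have : Fact (p : ℕ).Prime := ⟨p.2⟩
    have hne : ((φ i (e i) : ℤ) : ZMod p) ≠ 0 := by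
      rw [Ne, ZMod.intCast_zmod_eq_zero_iff_dvd]
      intro hdvd
      have h1 := Int.le_of_dvd (he i) hdvd
      have h2 := hN i
      omega
    have h1 := mul_right_cancel₀ hne h
    rw [ZMod.natCast_eq_natCast_iff'] at h1
    rw [Nat.mod_eq_of_lt x.2, Nat.mod_eq_of_lt y.2] at h1
    exact Fin.ext h1
  have hg : Function.Injective g := by
    rintro ⟨x, y⟩ ⟨x', y'⟩ h
    have h1 := congrArg (residue (φ i) p) h
    have h2 := congrArg (residue (φ j) p) h
    simp only [g, residue_cosetOf, map_add, map_nsmul, he0 i j hij.symm, he0 j i hij] at h1 h2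
    rw [Prod.mk.injEq]
    refine ⟨hcop i _ _ ?_, hcop j _ _ ?_⟩
    · simpa using h1
    · simpa using h2
  have hcard : (p : ℕ) ^ 2 ≤ Nat.card (CosetSpace G p) := by
    have := Nat.card_le_card_of_injective g hg
    simpa [sq] using this
  have hp0 : (0 : ℝ) < p := by exact_mod_cast p.2.pos
  rw [uniformCoset_real, Set.ncard_singleton, Nat.cast_one, one_div]
  exact inv_anti₀ (by positivity) (by exact_mod_cast hcard)

/-- The event that for all primes `p` of `s` the residue of the selected coset lies in `T p`. -/
def sieveEvent (f : G →+ ℤ) (s : Finset Nat.Primes) (T : (p : Nat.Primes) → Finset (ZMod p)) :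
    Set ((p : Nat.Primes) → CosetSpace G p) :=
  {B | ∀ p ∈ s, residue f p (B p) ∈ T p}

variable {f : G →+ ℤ} {s s' : Finset Nat.Primes} {T T' : (p : Nat.Primes) → Finset (ZMod p)}

theorem measurableSet_sieveEvent : MeasurableSet (sieveEvent f s T) :=
  MeasurableSet.pi s.countable_toSet (t := fun p => {b | residue f p b ∈ T p})
    fun _ _ => MeasurableSet.of_discrete

theorem cosetLaw_real_sieveEvent [AddGroup.FG G] (hf : Function.Surjective f) :
    (cosetLaw G).real (sieveEvent f s T) = ∏ p ∈ s, ((T p).card / (p : ℝ)) := by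
  have h1 : sieveEvent f s T = (s : Set Nat.Primes).pi fun p => {b | residue f p b ∈ T p} := rfl
  rw [h1, measureReal_def, cosetLaw, Measure.infinitePi_pi _ fun _ _ => MeasurableSet.of_discrete,
    ENNReal.toReal_prod]
  exact Finset.prod_congr rfl fun p _ => uniformCoset_real_residue hf p (T p)

theorem sieveEvent_inter : sieveEvent f s T ∩ sieveEvent f s T' =
    sieveEvent f s fun p => T p ∩ T' p := by
  ext B
  simp only [sieveEvent, Set.mem_inter_iff, Set.mem_ofPred_eq, Finset.mem_inter]
  exact ⟨fun h p hp => ⟨h.1 p hp, h.2 p hp⟩,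
    fun h => ⟨fun p hp => (h p hp).1, fun p hp => (h p hp).2⟩⟩

theorem cosetLaw_real_inter_of_disjoint [AddGroup.FG G] (hf : Function.Surjective f)
    (hs : Disjoint s s') :
    (cosetLaw G).real (sieveEvent f s T ∩ sieveEvent f s' T') =
      (cosetLaw G).real (sieveEvent f s T) * (cosetLaw G).real (sieveEvent f s' T') := by
  classical
  have h1 : sieveEvent f s T ∩ sieveEvent f s' T' =
      sieveEvent f (s ∪ s') fun p => if p ∈ s then T p else T' p := by
    ext B
    simp only [sieveEvent, Set.mem_inter_iff, Set.mem_ofPred_eq, Finset.mem_union]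
    constructor
    · rintro ⟨h, h'⟩ p hp
      split_ifs with hps
      · exact h p hps
      · exact h' p (hp.resolve_left hps)
    · intro h
      refine ⟨fun p hp => ?_, fun p hp => ?_⟩
      · simpa [hp] using h p (Or.inl hp)
      · simpa [Finset.disjoint_right.1 hs hp] using h p (Or.inr hp)
  rw [h1, cosetLaw_real_sieveEvent hf, cosetLaw_real_sieveEvent hf, cosetLaw_real_sieveEvent hf,
    Finset.prod_union hs]
  congr 1
  · exact Finset.prod_congr rfl fun p hp => by simp [hp]
  · exact Finset.prod_congr rfl fun p hp => by simp [Finset.disjoint_right.1 hs hp]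

end Residues

/-! ### The second moment method -/

/-- Chebyshev's inequality: conditionally on `A`, if the events `U j` have probability `u` and their
pairwise correlations are at most `ρ`, it is unlikely that none of them occurs. -/
theorem measureReal_inter_biInter_compl_le {Ω : Type*} [MeasurableSpace Ω] (μ : Measure Ω)
    [IsFiniteMeasure μ] {A : Set Ω} {U : ℕ → Set Ω}
    (hU : ∀ j, MeasurableSet (U j)) {m : ℕ} (hm : 0 < m) {u ρ : ℝ} (hu : 0 < u) (hρ : 0 ≤ ρ)
    (h1 : ∀ j < m, μ.real (A ∩ U j) = μ.real A * u)
    (h2 : ∀ j < m, ∀ l < m, j ≠ l → μ.real (A ∩ (U j ∩ U l)) ≤ μ.real A * (ρ * u ^ 2)) :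
    μ.real (A ∩ ⋂ j ∈ Finset.range m, (U j)ᶜ) ≤ μ.real A * (1 / (m * u) + (ρ - 1)) := by
  set V := ⋂ j ∈ Finset.range m, (U j)ᶜ with hV
  have hVm : MeasurableSet V := Finset.measurableSet_biInter _ fun j _ => (hU j).compl
  set ν := μ.restrict A with hν
  have hνr : ∀ s, MeasurableSet s → ν.real s = μ.real (A ∩ s) := fun s hs => by
    rw [hν, measureReal_restrict_apply hs, Set.inter_comm]
  set c : ℝ := m * u with hc
  have hm' : (0 : ℝ) < m := by exact_mod_cast hm
  have hcpos : 0 < c := by positivity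
  have hint : ∀ s, MeasurableSet s → Integrable (s.indicator (1 : Ω → ℝ)) ν := fun s hs =>
    (integrable_const (1 : ℝ)).indicator hs
  have hexp : ∀ ω, (∑ j ∈ Finset.range m, (U j).indicator (1 : Ω → ℝ) ω - c) ^ 2 =
      (∑ j ∈ Finset.range m, ∑ l ∈ Finset.range m, (U j ∩ U l).indicator (1 : Ω → ℝ) ω) -
        2 * c * (∑ j ∈ Finset.range m, (U j).indicator (1 : Ω → ℝ) ω) + c ^ 2 := by
    intro ω
    have : ∀ j l, (U j ∩ U l).indicator (1 : Ω → ℝ) ω =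
        (U j).indicator (1 : Ω → ℝ) ω * (U l).indicator (1 : Ω → ℝ) ω := fun j l => by
      rw [Set.inter_indicator_one, Pi.mul_apply]
    simp only [this, ← Finset.mul_sum, ← Finset.sum_mul]
    ring
  have hint1 : Integrable (fun ω => ∑ j ∈ Finset.range m, (U j).indicator (1 : Ω → ℝ) ω) ν :=
    integrable_finsetSum _ fun j _ => hint _ (hU j)
  have hint2 : Integrable (fun ω => ∑ j ∈ Finset.range m, ∑ l ∈ Finset.range m,
      (U j ∩ U l).indicator (1 : Ω → ℝ) ω) ν :=
    integrable_finsetSum _ fun j _ => integrable_finsetSum _ fun l _ =>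
      hint _ ((hU j).inter (hU l))
  have hint3 : Integrable (fun ω => 2 * c * ∑ j ∈ Finset.range m, (U j).indicator (1 : Ω → ℝ) ω) ν :=
    hint1.const_mul _
  have hint4 : Integrable (fun ω => (∑ j ∈ Finset.range m, ∑ l ∈ Finset.range m,
      (U j ∩ U l).indicator (1 : Ω → ℝ) ω) -
        2 * c * ∑ j ∈ Finset.range m, (U j).indicator (1 : Ω → ℝ) ω) ν := hint2.sub hint3
  have hI : ∫ ω, (∑ j ∈ Finset.range m, (U j).indicator (1 : Ω → ℝ) ω - c) ^ 2 ∂ν =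
      (∑ j ∈ Finset.range m, ∑ l ∈ Finset.range m, μ.real (A ∩ (U j ∩ U l))) -
        2 * c * (∑ j ∈ Finset.range m, μ.real (A ∩ U j)) + c ^ 2 * μ.real A := by
    simp only [hexp]
    rw [integral_add hint4 (integrable_const _), integral_sub hint2 hint3,
      integral_const_mul, integral_finsetSum _ fun j _ => hint _ (hU j),
      integral_finsetSum _ fun j _ => integrable_finsetSum _ fun l _ =>
      hint _ ((hU j).inter (hU l)), integral_const, smul_eq_mul, hνr _ MeasurableSet.univ,
      Set.inter_univ, mul_comm (μ.real A)]
    congr 2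
    · refine Finset.sum_congr rfl fun j _ => ?_
      rw [integral_finsetSum _ fun l _ => hint _ ((hU j).inter (hU l))]
      refine Finset.sum_congr rfl fun l _ => ?_
      rw [integral_indicator_one ((hU j).inter (hU l)), hνr _ ((hU j).inter (hU l))]
    · congr 1
      refine Finset.sum_congr rfl fun j _ => ?_
      rw [integral_indicator_one (hU j), hνr _ (hU j)]
  have hlow : c ^ 2 * μ.real (A ∩ V) ≤
      ∫ ω, (∑ j ∈ Finset.range m, (U j).indicator (1 : Ω → ℝ) ω - c) ^ 2 ∂ν := by
    rw [← hνr V hVm, ← integral_indicator_one hVm, ← integral_const_mul]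
    refine integral_mono ((hint V hVm).const_mul _) ?_ fun ω => ?_
    · simp only [hexp]
      exact hint4.add (integrable_const _)
    · by_cases hω : ω ∈ V
      · have h0 : ∑ j ∈ Finset.range m, (U j).indicator (1 : Ω → ℝ) ω = 0 :=
          Finset.sum_eq_zero fun j hj =>
            Set.indicator_of_notMem (Set.mem_iInter₂.1 hω j hj) _
        simp only [h0, Set.indicator_of_mem hω, Pi.one_apply]
        linarith
      · simp only [Set.indicator_of_notMem hω, mul_zero]
        positivity
  have hsum1 : ∑ j ∈ Finset.range m, μ.real (A ∩ U j) = c * μ.real A := by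
    rw [Finset.sum_congr rfl fun j hj => h1 j (Finset.mem_range.1 hj), Finset.sum_const,
      Finset.card_range, nsmul_eq_mul, hc]
    ring
  have hA0 : 0 ≤ μ.real A := measureReal_nonneg
  have hsum2 : ∑ j ∈ Finset.range m, ∑ l ∈ Finset.range m, μ.real (A ∩ (U j ∩ U l)) ≤
      c * μ.real A + ρ * c ^ 2 * μ.real A := by
    have hrow : ∀ j ∈ Finset.range m, ∑ l ∈ Finset.range m, μ.real (A ∩ (U j ∩ U l)) ≤
        μ.real A * u + m * (μ.real A * (ρ * u ^ 2)) := by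
      intro j hj
      rw [Finset.mem_range] at hj
      calc _ ≤ ∑ l ∈ Finset.range m, ((if l = j then μ.real A * u else 0) +
            μ.real A * (ρ * u ^ 2)) := by
            refine Finset.sum_le_sum fun l hl => ?_
            split_ifs with h
            · subst h
              rw [Set.inter_self, h1 l hj]
              have : 0 ≤ μ.real A * (ρ * u ^ 2) := by positivity
              linarith
            · rw [zero_add]
              exact h2 j hj l (Finset.mem_range.1 hl) (Ne.symm h)
        _ = _ := by
            rw [Finset.sum_add_distrib, Finset.sum_ite_eq', if_pos (Finset.mem_range.2 hj),
              Finset.sum_const, Finset.card_range, nsmul_eq_mul]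
    calc _ ≤ ∑ _j ∈ Finset.range m, (μ.real A * u + m * (μ.real A * (ρ * u ^ 2))) :=
          Finset.sum_le_sum hrow
      _ = _ := by
          rw [Finset.sum_const, Finset.card_range, nsmul_eq_mul, hc]
          ring
  rw [hI, hsum1] at hlow
  have hfin : c ^ 2 * μ.real (A ∩ V) ≤ c ^ 2 * (μ.real A * (1 / c + (ρ - 1))) := by
    have : c ^ 2 * (μ.real A * (1 / c + (ρ - 1))) =
        c * μ.real A + ρ * c ^ 2 * μ.real A - c ^ 2 * μ.real A := by
      field_simp
      ring
    rw [this]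
    nlinarith
  exact le_of_mul_le_mul_left hfin (by positivity)

section Estimates

variable {G : Type*} [AddCommGroup G] [AddGroup.FG G]

instance isProbabilityMeasure_cosetLaw : IsProbabilityMeasure (cosetLaw G) :=
  inferInstanceAs
    (IsProbabilityMeasure (Measure.infinitePi fun p : Nat.Primes => uniformCoset G p))

/-! ### Levels that are avoided by the small primes -/

/-- Consider the levels `t` of `f` in an interval of length `z ^ 3 * primorial z`, where `z = 2 ^ k`.
With high probability, some level is not hit by any selected coset of a prime up to `2 ^ (D * z)`.
A suitable residue `r` modulo `primorial z` rules out the primes up to `z`, and the second moment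
method applies to the levels `r + j * primorial z` with `j < z ^ 3`, whose pairwise differences have
few prime factors larger than `z`. -/
theorem cosetLaw_real_forall_level_hit_le {f : G →+ ℤ} (hf : Function.Surjective f) {k D : ℕ}
    (hk : 3 ≤ k) (hD : 1 ≤ D) (a : ℤ) :
    (cosetLaw G).real {B | ∀ t : ℤ, a ≤ t →
      t < a + ((2 ^ k) ^ 3 * primorial (2 ^ k) : ℕ) →
      ∃ p ∈ primesIoc 0 (2 ^ (D * 2 ^ k)), residue f p (B p) = t} ≤ (D ^ 2 + 12) / 2 ^ k := by
  classical
  set z := 2 ^ k with hz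
  set N := 2 ^ (D * z) with hN
  set Q := primorial z with hQ
  set m := z ^ 3 with hm
  have hz8 : 8 ≤ z := by
    rw [hz]
    calc 8 = 2 ^ 3 := rfl
      _ ≤ 2 ^ k := Nat.pow_le_pow_right two_pos hk
  have hz0 : (0 : ℝ) < z := by exact_mod_cast (by omega : 0 < z)
  have hkD : k ≤ D * z := (Nat.lt_two_pow_self (n := k)).le.trans (Nat.le_mul_of_pos_left _ hD)
  have hzN : z ≤ N := Nat.pow_le_pow_right two_pos hkD
  have hQ0 : 0 < Q := primorial_pos z
  have hm0 : 0 < m := by positivity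
  let A : ℤ → Set ((p : Nat.Primes) → CosetSpace G p) := fun r =>
    sieveEvent f (primesIoc 0 z) fun p => {((r : ZMod p) - 1)}
  let U : ℤ → ℕ → Set ((p : Nat.Primes) → CosetSpace G p) := fun r j =>
    sieveEvent f (primesIoc z N) fun p => {((r + j * Q : ℤ) : ZMod p)}ᶜ
  set u : ℝ := ∏ p ∈ primesIoc z N, (1 - 1 / (p : ℝ)) with hu
  have hu0 : 0 < u := Finset.prod_pos fun p _ => one_sub_one_div_prime_pos p
  have hulow : 1 / ((D * z : ℕ) : ℝ) ^ 2 ≤ u := one_div_sq_le_prod hk hkD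
  have hA : ∀ r, (cosetLaw G).real (A r) = 1 / Q := by
    intro r
    rw [cosetLaw_real_sieveEvent hf, hQ, ← prod_primesIoc_zero]
    push_cast
    rw [one_div, ← Finset.prod_inv_distrib]
    refine Finset.prod_congr rfl fun p _ => ?_
    rw [Finset.card_singleton, Nat.cast_one, one_div]
  have hcompl : ∀ (p : Nat.Primes) (x : ZMod p),
      ((({x}ᶜ : Finset (ZMod p)).card : ℝ)) / (p : ℝ) = 1 - 1 / (p : ℝ) := by
    intro p x
    have hp : (p : ℝ) ≠ 0 := by exact_mod_cast p.2.ne_zero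
    rw [Finset.card_compl, ZMod.card, Finset.card_singleton, Nat.cast_sub p.2.one_le, Nat.cast_one,
      sub_div, div_self hp]
  have hcompl2 : ∀ (p : Nat.Primes) (x y : ZMod p), x ≠ y →
      ((({x}ᶜ ∩ {y}ᶜ : Finset (ZMod p)).card : ℝ)) / (p : ℝ) = 1 - 2 / (p : ℝ) := by
    intro p x y hxy
    have hp : (p : ℝ) ≠ 0 := by exact_mod_cast p.2.ne_zero
    rw [← Finset.compl_union, Finset.card_compl, ZMod.card, ← Finset.insert_eq,
      Finset.card_pair hxy, Nat.cast_sub p.2.two_le, Nat.cast_ofNat, sub_div, div_self hp]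
  have hAU : ∀ r, ∀ j < m, (cosetLaw G).real (A r ∩ U r j) = (cosetLaw G).real (A r) * u := by
    intro r j _
    rw [cosetLaw_real_inter_of_disjoint hf (disjoint_primesIoc 0 z N), cosetLaw_real_sieveEvent hf
      (s := primesIoc z N)]
    congr 1
    exact Finset.prod_congr rfl fun p _ => hcompl p _
  have hAUU : ∀ r, ∀ j < m, ∀ l < m, j ≠ l → (cosetLaw G).real (A r ∩ (U r j ∩ U r l)) ≤
      (cosetLaw G).real (A r) * ((1 + 12 / z) * u ^ 2) := by
    intro r j hj l hl hjl
    rw [sieveEvent_inter, cosetLaw_real_inter_of_disjoint hf (disjoint_primesIoc 0 z N),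
      cosetLaw_real_sieveEvent hf (s := primesIoc z N)]
    refine mul_le_mul_of_nonneg_left ?_ measureReal_nonneg
    refine le_trans (le_of_eq ?_) (prod_pair_le (N := N) (by omega : 4 ≤ z)
      (h := ((j : ℤ) - l).natAbs) (by omega) (by omega))
    refine Finset.prod_congr rfl fun p hp => ?_
    have hpz := (mem_primesIoc.1 hp).1
    have hiff : ((r + j * Q : ℤ) : ZMod p) = ((r + l * Q : ℤ) : ZMod p) ↔
        (p : ℕ) ∣ ((j : ℤ) - l).natAbs := by
      rw [eq_comm, ZMod.intCast_eq_intCast_iff_dvd_sub,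
        show (r + j * Q - (r + l * Q) : ℤ) = (j - l) * Q by ring, Int.natCast_dvd, Int.natAbs_mul,
        p.2.dvd_mul, Int.natAbs_natCast, hQ, p.2.dvd_primorial_iff]
      exact or_iff_left (by omega)
    split_ifs with hd
    · rw [hiff.2 hd, Finset.inter_self, hcompl]
    · exact hcompl2 p _ _ (mt hiff.1 hd)
  have hε : ∀ r, (cosetLaw G).real (A r ∩ ⋂ j ∈ Finset.range m, (U r j)ᶜ) ≤
      1 / Q * ((D ^ 2 + 12) / z) := by
    intro r
    refine (measureReal_inter_biInter_compl_le (cosetLaw G) (fun j => measurableSet_sieveEvent) hm0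
      hu0 (by positivity) (hAU r) (hAUU r)).trans ?_
    rw [hA]
    refine mul_le_mul_of_nonneg_left ?_ (by positivity)
    have h1 : 1 / ((m : ℝ) * u) ≤ D ^ 2 / z := by
      have hD0 : (0 : ℝ) < D := by exact_mod_cast hD
      calc 1 / ((m : ℝ) * u) ≤ 1 / ((m : ℝ) * (1 / ((D * z : ℕ) : ℝ) ^ 2)) := by
            refine one_div_le_one_div_of_le ?_ (mul_le_mul_of_nonneg_left hulow (by positivity))
            push_cast
            positivity
        _ = D ^ 2 / z := by
            rw [hm]
            push_cast
            field_simp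
    rw [add_div]
    linarith
  have hsub : {B : (p : Nat.Primes) → CosetSpace G p | ∀ t : ℤ, a ≤ t → t < a + (m * Q : ℕ) →
      ∃ p ∈ primesIoc 0 N, residue f p (B p) = t} ⊆
      ⋃ r ∈ Finset.Ico a (a + Q), (A r ∩ ⋂ j ∈ Finset.range m, (U r j)ᶜ) := by
    intro B hB
    obtain ⟨r, har, hrQ, hr⟩ := exists_int_residues (fun p => residue f p (B p) + 1) z a
    refine Set.mem_iUnion₂.2 ⟨r, Finset.mem_Ico.2 ⟨har, hrQ⟩, fun p hp => ?_,
      Set.mem_iInter₂.2 fun j hj hBU => ?_⟩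
    · rw [Finset.mem_singleton, hr p hp, add_sub_cancel_right]
    · have hj' : j + 1 ≤ m := Finset.mem_range.1 hj
      have h1 : ((j : ℤ) + 1) * Q ≤ m * Q :=
        mul_le_mul_of_nonneg_right (by exact_mod_cast hj') (by positivity)
      have h2 : (0 : ℤ) ≤ j * Q := by positivity
      obtain ⟨p, hp, hpt⟩ := hB (r + j * Q) (by linarith) (by push_cast; linarith)
      by_cases hpz : (p : ℕ) ≤ z
      · -- the residue `r` avoids the selected cosets of the primes up to `z`
        have hp' : p ∈ primesIoc 0 z := mem_primesIoc.2 ⟨p.2.pos, hpz⟩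
        have hQp : ((Q : ℕ) : ZMod p) = 0 :=
          (ZMod.natCast_eq_zero_iff _ _).2 (p.2.dvd_primorial_iff.2 hpz)
        have h3 := hr p hp'
        push_cast at hpt
        rw [hQp, mul_zero, add_zero, h3] at hpt
        have : Fact (p : ℕ).Prime := ⟨p.2⟩
        exact one_ne_zero (left_eq_add.1 hpt)
      · have h4 := hBU p (mem_primesIoc.2 ⟨by omega, (mem_primesIoc.1 hp).2⟩)
        rw [Finset.mem_compl, Finset.mem_singleton] at h4
        exact h4 hpt
  calc _ ≤ (cosetLaw G).real (⋃ r ∈ Finset.Ico a (a + Q), (A r ∩ ⋂ j ∈ Finset.range m, (U r j)ᶜ)) :=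
        measureReal_mono hsub (measure_ne_top _ _)
    _ ≤ ∑ r ∈ Finset.Ico a (a + Q), (cosetLaw G).real (A r ∩ ⋂ j ∈ Finset.range m, (U r j)ᶜ) :=
        measureReal_biUnion_finset_le _ _
    _ ≤ ∑ _r ∈ Finset.Ico a (a + Q), 1 / (Q : ℝ) * ((D ^ 2 + 12) / z) :=
        Finset.sum_le_sum fun r _ => hε r
    _ = (D ^ 2 + 12) / 2 ^ k := by
        have hQ' : (Q : ℝ) ≠ 0 := by exact_mod_cast hQ0.ne'
        rw [Finset.sum_const, Int.card_Ico, add_sub_cancel_left, Int.toNat_natCast, nsmul_eq_mul,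
          ← mul_assoc, mul_one_div_cancel hQ', one_mul, hz]
        push_cast
        rfl

/-! ### Boxes that are avoided by the large primes -/

theorem cosetLaw_cosetOf_le {ι : Type*} [Nontrivial ι] {φ : ι → G →+ ℤ} {e : ι → G}
    (he : ∀ i, 0 < φ i (e i)) (he0 : ∀ i j, j ≠ i → φ j (e i) = 0) {N : ℕ}
    (hN : ∀ i, φ i (e i) ≤ N) (p : Nat.Primes) (hp : N < p) (v : G) :
    cosetLaw G {B | cosetOf p v = B p} ≤ ENNReal.ofReal ((p : ℝ) ^ 2)⁻¹ := by
  have h1 : {B : (p : Nat.Primes) → CosetSpace G p | cosetOf p v = B p} =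
      Function.eval p ⁻¹' ({cosetOf (p : ℕ) v} : Set (CosetSpace G p)) := by
    ext B
    exact eq_comm
  rw [h1, cosetLaw, (measurePreserving_eval_infinitePi _ p).measure_preimage
    (MeasurableSet.of_discrete).nullMeasurableSet, ← ofReal_measureReal]
  exact ENNReal.ofReal_le_ofReal (uniformCoset_real_singleton_le he he0 hN p hp _)

theorem cosetLaw_exists_mem_box_le {ι : Type*} [Fintype ι] [Nontrivial ι] {φ : ι → G →+ ℤ}
    (hφ : IsCoordinates φ) {e : ι → G} (he : ∀ i, 0 < φ i (e i))
    (he0 : ∀ i j, j ≠ i → φ j (e i) = 0) {N : ℕ} (hN : ∀ i, φ i (e i) ≤ N) (hN0 : N ≠ 0) (L : ℕ) :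
    cosetLaw G {B | ∃ v ∈ box φ L, ∃ p : Nat.Primes, N < p ∧ cosetOf p v = B p} ≤
      ENNReal.ofReal ((2 * L + 1) ^ Fintype.card ι / N) := by
  classical
  have hpoint : ∀ v : G, cosetLaw G {B | ∃ p : Nat.Primes, N < p ∧ cosetOf p v = B p} ≤
      ENNReal.ofReal (1 / N) := by
    intro v
    let E : ℕ → Set ((p : Nat.Primes) → CosetSpace G p) := fun n =>
      {B | ∃ h : n.Prime, N < n ∧ cosetOf n v = B ⟨n, h⟩}
    have hE : ∀ n, cosetLaw G (E n) ≤ ENNReal.ofReal (if N < n then ((n : ℝ) ^ 2)⁻¹ else 0) := by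
      intro n
      by_cases hn : n.Prime ∧ N < n
      · have h1 : E n = {B | cosetOf n v = B ⟨n, hn.1⟩} := by
          ext B
          exact ⟨fun h => h.2.2, fun h => ⟨hn.1, hn.2, h⟩⟩
        rw [h1, if_pos hn.2]
        exact cosetLaw_cosetOf_le he he0 hN ⟨n, hn.1⟩ hn.2 v
      · have h1 : E n = ∅ := by
          ext B
          simp only [Set.mem_empty_iff_false, iff_false]
          exact fun h => hn ⟨h.1, h.2.1⟩
        rw [h1, measure_empty]
        exact zero_le
    calc _ ≤ cosetLaw G (⋃ n, E n) := by
          refine measure_mono ?_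
          rintro B ⟨p, hp, hB⟩
          exact Set.mem_iUnion.2 ⟨p, p.2, hp, hB⟩
      _ ≤ ∑' n, cosetLaw G (E n) := measure_iUnion_le _
      _ ≤ ∑' n : ℕ, ENNReal.ofReal (if N < n then ((n : ℝ) ^ 2)⁻¹ else 0) := ENNReal.tsum_le_tsum hE
      _ ≤ ENNReal.ofReal (1 / N) := by
          refine ENNReal.tsum_le_of_sum_range_le fun n => ?_
          rw [← ENNReal.ofReal_sum_of_nonneg fun i _ => by positivity, ← Finset.sum_filter]
          refine ENNReal.ofReal_le_ofReal ?_
          calc _ ≤ ∑ i ∈ Finset.Ioc N (N + n), ((i : ℝ) ^ 2)⁻¹ := by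
                refine Finset.sum_le_sum_of_subset_of_nonneg ?_ fun i _ _ => by positivity
                intro i hi
                rw [Finset.mem_filter, Finset.mem_range] at hi
                rw [Finset.mem_Ioc]
                omega
            _ ≤ (N : ℝ)⁻¹ - ((N + n : ℕ) : ℝ)⁻¹ := sum_Ioc_inv_sq_le_sub hN0 (by omega)
            _ ≤ 1 / N := by
                rw [one_div]
                exact sub_le_self _ (by positivity)
  have hsub : {B : (p : Nat.Primes) → CosetSpace G p |
        ∃ v ∈ box φ L, ∃ p : Nat.Primes, N < p ∧ cosetOf p v = B p} ⊆
      ⋃ v ∈ (box_finite hφ L).toFinset, {B | ∃ p : Nat.Primes, N < p ∧ cosetOf p v = B p} := by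
    rintro B ⟨v, hv, hB⟩
    exact Set.mem_iUnion₂.2 ⟨v, (box_finite hφ L).mem_toFinset.2 hv, hB⟩
  calc _ ≤ _ := measure_mono hsub
    _ ≤ ∑ v ∈ (box_finite hφ L).toFinset, _ := measure_biUnion_finset_le _ _
    _ ≤ ∑ _v ∈ (box_finite hφ L).toFinset, ENNReal.ofReal (1 / N) :=
        Finset.sum_le_sum fun v _ => hpoint v
    _ ≤ _ := by
        rw [Finset.sum_const, ← Set.ncard_eq_toFinset_card _ (box_finite hφ L), nsmul_eq_mul,
          ← ENNReal.ofReal_natCast, ← ENNReal.ofReal_mul (by positivity), mul_one_div]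
        refine ENNReal.ofReal_le_ofReal (div_le_div_of_nonneg_right ?_ (by positivity))
        exact_mod_cast ncard_box_le hφ L

end Estimates

/-! ### Almost sure uniqueness -/

/-- For `z = 2 ^ k`, the window of levels to which the sieve estimate applies fits into `64 ^ z`. -/
theorem level_window_le (k : ℕ) : k + (2 ^ k) ^ 3 * primorial (2 ^ k) ≤ 64 ^ 2 ^ k := by
  set z := 2 ^ k with hz
  have hk : k ≤ z := Nat.lt_two_pow_self.le
  have hz1 : 1 ≤ z := Nat.one_le_two_pow
  have h1 : z ^ 3 * primorial z ≤ 32 ^ z := by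
    calc z ^ 3 * primorial z ≤ (2 ^ z) ^ 3 * 4 ^ z := Nat.mul_le_mul
          (Nat.pow_le_pow_left Nat.lt_two_pow_self.le 3) (primorial_le_four_pow z)
      _ = 32 ^ z := by
          rw [← pow_mul, mul_comm z 3, pow_mul, ← mul_pow]
          norm_num
  have h2 : z ≤ 32 ^ z := (Nat.lt_pow_self (by norm_num)).le
  have h3 : 2 * 32 ^ z ≤ 64 ^ z := by
    rw [show (64 : ℕ) = 2 * 32 from rfl, mul_pow]
    exact Nat.mul_le_mul_right _ (Nat.le_self_pow (by omega) 2)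
  omega

theorem ae_encard_infiniteClusters_eq_one {G ι : Type*} [AddCommGroup G] [AddGroup.FG G]
    [Fintype ι] [Nontrivial ι] {φ : ι → G →+ ℤ} (hφ : IsCoordinates φ) {S : Set G}
    (hS : Admissible S) (hsep : HyperplanesSeparate φ S) :
    ∀ᵐ B ∂(cosetLaw G), (infiniteClusters (SimpleGraph.addCayley S) (white B)).encard = 1 := by
  obtain ⟨C, hC⟩ := exists_encard_infiniteClusters_eq_one hφ hS hsep
  choose e he he0 using hφ.exists_axis
  obtain ⟨c, hc⟩ := (Set.finite_range e).exists_subset_box φ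
  set d := Fintype.card ι with hd
  -- the primes up to `2 ^ (D * 2 ^ k)` are sieved; larger ones are too sparse to matter in the box
  obtain ⟨A, hA⟩ : ∃ A, A = ((2 * C + 1) * 4096) ^ d := ⟨_, rfl⟩
  have hA1 : 1 ≤ A := hA ▸ Nat.one_le_pow _ _ (by omega)
  obtain ⟨D, hD⟩ : ∃ D, D = 2 * A + c := ⟨_, rfl⟩
  let K : ℕ → ℕ := fun k => 64 ^ 2 ^ k
  let N : ℕ → ℕ := fun k => 2 ^ (D * 2 ^ k)
  let E : ℕ → ι → ℤ → Set ((p : Nat.Primes) → CosetSpace G p) := fun k i a =>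
    {B | ∀ t : ℤ, a ≤ t → t < a + ((2 ^ k) ^ 3 * primorial (2 ^ k) : ℕ) →
      ∃ p ∈ primesIoc 0 (N k), residue (φ i) p (B p) = t}
  let F : ℕ → Set ((p : Nat.Primes) → CosetSpace G p) := fun k =>
    {B | ∃ v ∈ box φ ((C * K (k + 1) : ℕ) : ℤ), ∃ p : Nat.Primes, N k < p ∧ cosetOf p v = B p}
  let lo : ℕ → ℤ := fun k => -((k + (2 ^ k) ^ 3 * primorial (2 ^ k) : ℕ) : ℤ)
  let bad : ℕ → Set ((p : Nat.Primes) → CosetSpace G p) := fun k =>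
    (⋃ i ∈ Finset.univ, (E k i k ∪ E k i (lo k))) ∪ F k
  have hE : ∀ k, 3 ≤ k → ∀ i a, cosetLaw G (E k i a) ≤
      ENNReal.ofReal ((D ^ 2 + 12) / 2 ^ k) := fun k hk i a => by
    rw [← ofReal_measureReal]
    exact ENNReal.ofReal_le_ofReal
      (cosetLaw_real_forall_level_hit_le (hφ.surjective i) hk (by omega) a)
  have hDN : ∀ k, D ≤ N k := fun k =>
    Nat.lt_two_pow_self.le.trans (Nat.pow_le_pow_right two_pos
      (Nat.le_mul_of_pos_right _ (by positivity)))
  have hF : ∀ k, cosetLaw G (F k) ≤ ENNReal.ofReal (1 / 2 ^ k) := fun k => by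
    refine (cosetLaw_exists_mem_box_le hφ he he0 (N := N k) (fun i => ?_) (by positivity) _).trans
      (ENNReal.ofReal_le_ofReal ?_)
    · have h1 := (le_abs_self _).trans (hc (Set.mem_range_self i) i)
      have h2 := hDN k
      omega
    · rw [div_le_div_iff₀ (by positivity) (by positivity), one_mul]
      set z := 2 ^ k with hz
      have hkz : 2 ^ k ≤ 2 ^ z := Nat.pow_le_pow_right two_pos Nat.lt_two_pow_self.le
      have h1 : 2 * (C * K (k + 1)) + 1 ≤ ((2 * C + 1) * 4096) ^ z := by
        have h2 : K (k + 1) = 4096 ^ z := by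
          change 64 ^ 2 ^ (k + 1) = _
          rw [pow_succ', pow_mul, ← hz]
          norm_num
        rw [h2, mul_pow]
        calc 2 * (C * 4096 ^ z) + 1 ≤ (2 * C + 1) * 4096 ^ z := by
              have : 1 ≤ 4096 ^ z := Nat.one_le_pow _ _ (by norm_num)
              linarith
          _ ≤ _ := Nat.mul_le_mul_right _ (Nat.le_self_pow (by positivity) _)
      have h3 : (2 * (C * K (k + 1)) + 1) ^ d * 2 ^ k ≤ N k := by
        calc _ ≤ (((2 * C + 1) * 4096) ^ z) ^ d * 2 ^ z :=
              Nat.mul_le_mul (Nat.pow_le_pow_left h1 d) hkz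
          _ = (A * 2) ^ z := by
              rw [hA, mul_pow (_ ^ d) 2 z, ← pow_mul, ← pow_mul, mul_comm z d]
          _ ≤ (2 ^ D) ^ z := by
              refine Nat.pow_le_pow_left ?_ z
              have : D < 2 ^ D := Nat.lt_two_pow_self
              omega
          _ = N k := by rw [← pow_mul]
      exact_mod_cast h3
  have hbad : ∀ k, 3 ≤ k → cosetLaw G (bad k) ≤
      ENNReal.ofReal ((d * (2 * (D ^ 2 + 12)) + 1) / 2 ^ k) := fun k hk => by
    calc cosetLaw G (bad k) ≤
          ∑ _i : ι, (ENNReal.ofReal ((D ^ 2 + 12) / 2 ^ k) +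
            ENNReal.ofReal ((D ^ 2 + 12) / 2 ^ k)) + ENNReal.ofReal (1 / 2 ^ k) := by
          refine (measure_union_le _ _).trans (add_le_add ?_ (hF k))
          refine (measure_biUnion_finset_le _ _).trans (Finset.sum_le_sum fun i _ => ?_)
          exact (measure_union_le _ _).trans (add_le_add (hE k hk i _) (hE k hk i _))
      _ = _ := by
          rw [Finset.sum_const, Finset.card_univ, nsmul_eq_mul, ← hd,
            ← ENNReal.ofReal_add (by positivity) (by positivity), ← ENNReal.ofReal_natCast,
            ← ENNReal.ofReal_mul (by positivity), ← ENNReal.ofReal_add (by positivity)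
              (by positivity)]
          congr 1
          ring
  have hsum : ∑' k, cosetLaw G (bad (k + 3)) ≠ ⊤ := by
    refine ne_top_of_le_ne_top (Summable.tsum_ofReal_ne_top (f := fun k : ℕ =>
      ((d * (2 * (D ^ 2 + 12)) + 1) / 2 ^ (k + 3) : ℝ)) ?_)
      (ENNReal.tsum_le_tsum fun k => hbad (k + 3) (by omega))
    have h1 := (summable_geometric_of_lt_one (by norm_num : (0 : ℝ) ≤ 1 / 2)
      (by norm_num)).mul_left (((d : ℝ) * (2 * (D ^ 2 + 12)) + 1) / 8)
    refine h1.congr fun k => ?_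
    rw [pow_add, one_div_pow]
    field_simp
    norm_num
  filter_upwards [ae_eventually_notMem hsum] with B hB
  obtain ⟨k₀, hk₀⟩ := Filter.eventually_atTop.1 hB
  refine hC K (white B) (k₀ + 3) (fun a b hab => Nat.pow_le_pow_right (by norm_num)
    (Nat.pow_le_pow_right two_pos hab)) (fun k => Nat.one_le_pow _ _ (by norm_num))
    fun k hk i => ?_
  obtain ⟨l, rfl⟩ : ∃ l, k = l + 3 := ⟨k - 3, by omega⟩
  generalize hkl : l + 3 = k at hk
  have hnot : B ∉ bad k := hkl ▸ hk₀ l (by omega)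
  have hEi : ∀ a, (a = (k : ℤ) ∨ a = lo k) → B ∉ E k i a := by
    rintro a (rfl | rfl) h
    · exact hnot (Or.inl (Set.mem_iUnion₂.2 ⟨i, Finset.mem_univ _, Or.inl h⟩))
    · exact hnot (Or.inl (Set.mem_iUnion₂.2 ⟨i, Finset.mem_univ _, Or.inr h⟩))
  have hFk : B ∉ F k := fun h => hnot (Or.inr h)
  have hwall : ∀ t : ℤ, (∀ p ∈ primesIoc 0 (N k), residue (φ i) p (B p) ≠ t) →
      WallIn φ (white B) (C * K (k + 1)) i t := by
    rintro t ht v hv rfl hvB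
    obtain ⟨p, hp⟩ := Set.mem_iUnion.1 hvB
    have hp' : cosetOf p v = B p := hp
    by_cases hpN : (p : ℕ) ≤ N k
    · refine ht p (mem_primesIoc.2 ⟨p.2.pos, hpN⟩) ?_
      rw [← hp', residue_cosetOf]
    · exact hFk ⟨v, by exact_mod_cast hv, p, not_le.1 hpN, hp'⟩
  have hex : ∀ a, (a = (k : ℤ) ∨ a = lo k) → ∃ t : ℤ, a ≤ t ∧
      t < a + ((2 ^ k) ^ 3 * primorial (2 ^ k) : ℕ) ∧
      WallIn φ (white B) (C * K (k + 1)) i t := by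
    intro a ha
    have h1 := hEi a ha
    simp only [E, Set.mem_ofPred_eq, not_forall, not_exists, not_and] at h1
    obtain ⟨t, h2, h3, h4⟩ := h1
    exact ⟨t, h2, h3, hwall t h4⟩
  have hwin : (k : ℤ) + ((2 ^ k) ^ 3 * primorial (2 ^ k) : ℕ) ≤ K k := by
    exact_mod_cast level_window_le k
  have hlo : lo k = -(k + ((2 ^ k) ^ 3 * primorial (2 ^ k) : ℕ) : ℤ) := by
    simp only [lo]
    push_cast
    rfl
  obtain ⟨t, h1, h2, h3⟩ := hex k (Or.inl rfl)
  obtain ⟨t', h1', h2', h3'⟩ := hex (lo k) (Or.inr rfl)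
  rw [hlo] at h1' h2'
  exact ⟨⟨t, h1, by linarith, h3⟩, t', by linarith, by linarith, h3'⟩

/-! ### Coordinates on a finite-index subgroup of `ℤ ^ d` -/

theorem exists_surjective_of_ne_zero {G : Type*} [AddGroup G] (π : G →+ ℤ) (hπ : π ≠ 0) :
    ∃ (m : ℤ) (f : G →+ ℤ), 0 < m ∧ Function.Surjective f ∧ ∀ x, π x = m * f x := by
  obtain ⟨a, ha⟩ := Int.subgroup_cyclic π.range
  rw [← AddSubgroup.zmultiples_eq_closure] at ha
  have hdvd : ∀ x, a ∣ π x := fun x => by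
    have h1 : π x ∈ AddSubgroup.zmultiples a := ha ▸ ⟨x, rfl⟩
    exact Int.mem_zmultiples_iff.1 h1
  have ha0 : a ≠ 0 := by
    rintro rfl
    refine hπ (AddMonoidHom.ext fun x => ?_)
    simpa using hdvd x
  have hdvd' : ∀ x, |a| ∣ π x := fun x => (abs_dvd _ _).2 (hdvd x)
  have hpos : 0 < |a| := abs_pos.2 ha0
  refine ⟨|a|, AddMonoidHom.mk' (fun x => π x / |a|) fun x y => ?_, hpos, fun n => ?_, fun x => ?_⟩
  · rw [map_add, Int.add_ediv_of_dvd_left (hdvd' x)]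
  · have h1 : |a| * n ∈ π.range := by
      rw [ha]
      exact Int.mem_zmultiples_iff.2 ((dvd_abs _ _).2 dvd_rfl |>.mul_right n)
    obtain ⟨x, hx⟩ := h1
    refine ⟨x, ?_⟩
    rw [AddMonoidHom.mk'_apply, hx, Int.mul_ediv_cancel_left _ hpos.ne']
  · rw [AddMonoidHom.mk'_apply, Int.mul_ediv_cancel' (hdvd' x)]

theorem exists_coordinates {d : ℕ} (Γ : AddSubgroup (Fin d → ℤ)) (hΓ : Γ.FiniteIndex) :
    ∃ (m : Fin d → ℤ) (φ : Fin d → Γ →+ ℤ), (∀ i, 0 < m i) ∧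
      (∀ i (x : Γ), (x : Fin d → ℤ) i = m i * φ i x) ∧ IsCoordinates φ := by
  let π : Fin d → Γ →+ ℤ := fun i => (Pi.evalAddMonoidHom (fun _ : Fin d => ℤ) i).comp Γ.subtype
  let e : Fin d → Γ := fun i => ⟨Γ.index • Pi.single i 1, Γ.nsmul_index_mem _⟩
  have hidx : (0 : ℤ) < Γ.index := by exact_mod_cast Nat.pos_of_ne_zero hΓ.index_ne_zero
  have he : ∀ i, π i (e i) = Γ.index := fun i => by simp [π, e]
  have he0 : ∀ i j, j ≠ i → π j (e i) = 0 := fun i j hj => by simp [π, e, hj]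
  have hπ : ∀ i, π i ≠ 0 := fun i h => by
    have := he i
    rw [h, AddMonoidHom.zero_apply] at this
    omega
  choose m φ hm hφ hmφ using fun i => exists_surjective_of_ne_zero (π i) (hπ i)
  refine ⟨m, φ, hm, hmφ, hφ, fun x hx => ?_, fun i => ⟨e i, ?_, fun j hj => ?_⟩⟩
  · ext i
    have := hmφ i x
    rw [hx, mul_zero] at this
    exact this
  · have := hmφ i (e i)
    rw [he] at this
    exact pos_of_mul_pos_right (this ▸ hidx) (hm i).le
  · have := hmφ j (e i)
    rw [he0 i j hj] at this
    exact (mul_eq_zero.1 this.symm).resolve_left (hm j).ne'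

end CoprimeColouring

theorem theorem5p1 (d : ℕ) (hd : 2 ≤ d) (Γ : AddSubgroup (Fin d → ℤ)) (hΓ : Γ.FiniteIndex)
    (S : Set Γ) (hS : CoprimeColouring.Admissible S)
    (hconn : ∀ i : Fin d,
      ((SimpleGraph.addCayley S).induce {x : Γ | (x : Fin d → ℤ) i = 0}).Connected)
    (hcross : ∀ i : Fin d, ∀ x z : Γ, (SimpleGraph.addCayley S).Adj x z →
      (x : Fin d → ℤ) i < 0 → 0 < (z : Fin d → ℤ) i →
      ∃ y : Γ, ((SimpleGraph.addCayley S).Adj y x ∨ (SimpleGraph.addCayley S).Adj y z) ∧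
        (y : Fin d → ℤ) i = 0) :
    ∀ᵐ B ∂(CoprimeColouring.cosetLaw Γ),
      (CoprimeColouring.infiniteClusters (SimpleGraph.addCayley S)
        (CoprimeColouring.white B)).encard = 1 := by
  obtain ⟨m, φ, hm, hmφ, hφ⟩ := CoprimeColouring.exists_coordinates Γ hΓ
  have hnt : Nontrivial (Fin d) := Fin.nontrivial_iff_two_le.2 hd
  have hzero : ∀ i (x : Γ), (x : Fin d → ℤ) i = 0 ↔ φ i x = 0 := fun i x => by
    rw [hmφ, mul_eq_zero, or_iff_right (hm i).ne']
  refine CoprimeColouring.ae_encard_infiniteClusters_eq_one hφ hS ⟨fun i => ?_, ?_⟩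
  · have h1 : {x : Γ | φ i x = 0} = {x : Γ | (x : Fin d → ℤ) i = 0} :=
      Set.ext fun x => (hzero i x).symm
    rw [h1]
    exact hconn i
  · intro i x z hxz hx hz
    obtain ⟨y, hy, hy0⟩ := hcross i x z hxz
      (by rw [hmφ]; exact mul_neg_of_pos_of_neg (hm i) hx)
      (by rw [hmφ]; exact mul_pos (hm i) hz)
    exact ⟨y, hy, (hzero i y).1 hy0⟩
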